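/- Let $M$ be a complex manifold of complex dimension $n$ with complex structure $J$, and let $g$ be a smooth Hermitian metric on $M$. In holomorphic coordinates write $g_{j\bar k}$ for its components, normalized so that $g(u,v)=\operatorname{Re}\sum g_{j\bar k}u^j\overline{v^k}$; thus the Kähler form $\omega(u,v)=-g(u,Jv)$ is $\omega=\frac{\sqrt{-1}}2 g_{j\bar k}\,dz^j\wedge d\bar z^k$. Let $g^{k\bar l}$ be the inverse, $g^{k\bar l}g_{j\bar l}=\delta^k_j$. The Chern connection has $\Gamma_{ij}^k=g^{k\bar l}\partial_i g_{j\bar l}$, torsion $T_{ij\bar k}=g_{l\bar k}(\Gamma^l_{ij}-\Gamma^l_{ji})$, $T_{\bar i\bar j k}=\overline{T_{ij\bar k}}$, and curvature $\Omega_{l\bar m j\bar k}=-g_{p\bar k}\,\partial_{\bar m}\Gamma^p_{lj}$. Put $S_{j\bar k}=g^{l\bar m}\Omega_{l\bar m j\bar k}$ and $$Q^1_{i\bar j}=g^{k\bar l}g^{m\bar n}T_{ik\bar n}T_{\bar j\bar l m},\qquad Q^2_{i\bar j}=g^{k\bar l}g^{m\bar n}T_{\bar l\bar n i}T_{km\bar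 j},\qquad Q^3_{i\bar j}=g^{k\bar l}g^{m\bar n}T_{ik\bar l}T_{\bar j\bar n m},$$ $$Q^4_{i\bar j}=\tfrac12 g^{k\bar l}g^{m\bar n}\left(T_{mk\bar l}T_{\bar n\bar j i}+T_{\bar n\bar l k}T_{mi\bar j}\right),\qquad Q=\tfrac12Q^1-\tfrac14Q^2-\tfrac12Q^3+Q^4.$$ Let $\partial_g^*,\bar\partial_g^*$ be the (formal) $L^2$ adjoints of $\partial,\bar\partial$ for the Hermitian inner product on forms induced by $\langle dz^i,dz^j\rangle=g^{i\bar j}$ and the volume form $\omega^n/n!$. For a $(1,0)$-form $\alpha=\alpha_p\,dz^p$ and a $(1,2)$-form $\beta=\frac12\beta_{j\bar q\bar k}\,dz^j\wedge d\bar z^q\wedge d\bar z^k$ put $(\alpha\lrcorner\beta)_{j\bar k}=g^{p\bar q}\alpha_p\beta_{j\bar q\bar k}$. Let $$\Psi(\omega)=\partial_g^*\partial\omega-\partial\partial_g^*\omega-\frac{\sqrt{-1}}2\partial\bar\partial\log\det g-2\sqrt{-1}\left(\bar\partial_g^*\omega\lrcorner\bar\partial\omega\right).$$ (1) The adjoint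 forms $\partial_g^*\omega$, $\bar\partial_g^*\omega$, $\partial_g^*\partial\omega$ exist and are unique. Let $\Xi(g)(u,v)=-S(u,Jv)=S(Ju,v)$ be the $(1,1)$-form associated with $S$ in the way $\omega$ is associated with $g$. In all holomorphic coordinates $$\Xi(g)_{j\bar k}=\Psi(\omega)_{j\bar k}-\frac{\sqrt{-1}}2\left(\tfrac12Q^2_{j\bar k}-2Q^4_{j\bar k}\right).$$ (2) Let $g(t)$ be a family of smooth Hermitian metrics on $M$ and $D\subseteq\mathbb R$ a set of times (for example an interval). Then $g(t)$ satisfies the Hermitian curvature flow equation $\frac{\partial}{\partial t}g=-S+Q$ for $t\in D$ if and only if its Kähler forms satisfy, for $t\in D$, $$\frac{\partial}{\partial t}\omega=-\Psi(\omega)+\frac{\sqrt{-1}}2\left(\tfrac12Q^1+\tfrac14Q^2-\tfrac12Q^3-Q^4\right).$$ (Here a tensor $A_{j\bar k}$ in a bracket after $\frac{\sqrt{-1}}2$ stands for the form $\frac{\sqrt{-1}}2A_{j\bar k}\,dz^j\wedge d\bar z^k$; time derivatives are taken within $D$.) -/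

import Mathlib

open scoped Manifold ContDiff ComplexConjugate
open MeasureTheory

noncomputable section

namespace HermitianFlow

/-- Complex coordinate space `ℂⁿ`. -/
abbrev CSpace (n : ℕ) : Type := Fin n → ℂ

/-! ### Calculus in complex coordinates -/

/-- `∂f/∂zⁱ = ½ (∂f/∂xⁱ - √-1 ∂f/∂yⁱ)`. -/
def dz {n : ℕ} (i : Fin n) (f : CSpace n → ℂ) (z : CSpace n) : ℂ :=
  (1 / 2 : ℂ) * (fderiv ℝ f z (Pi.single i 1) - Complex.I * fderiv ℝ f z (Pi.single i Complex.I))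

/-- `∂f/∂z̄ⁱ = ½ (∂f/∂xⁱ + √-1 ∂f/∂yⁱ)`. -/
def dzbar {n : ℕ} (i : Fin n) (f : CSpace n → ℂ) (z : CSpace n) : ℂ :=
  (1 / 2 : ℂ) * (fderiv ℝ f z (Pi.single i 1) + Complex.I * fderiv ℝ f z (Pi.single i Complex.I))

/-- Components of a `(p,q)`-form in complex coordinates:
`α = 1/(p! q!) ∑ α_{I J̄} dz^{I₁} ∧ ⋯ ∧ dz^{I_p} ∧ dz̄^{J₁} ∧ ⋯ ∧ dz̄^{J_q}`;
the entry `α z I J` is the value `α(∂_{I₁}, …, ∂_{I_p}, ∂_{J̄₁}, …, ∂_{J̄_q})` at the point `z`. -/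
abbrev CForm (n p q : ℕ) : Type :=
  CSpace n → (Fin p → Fin n) → (Fin q → Fin n) → ℂ

/-- `α` is a smooth `(p,q)`-form on `U`: its components are smooth on `U` and alternating in the
holomorphic indices and in the antiholomorphic ones. -/
structure IsSmoothForm {n p q : ℕ} (U : Set (CSpace n)) (α : CForm n p q) : Prop where
  smooth : ∀ I J, ContDiffOn ℝ ∞ (fun z => α z I J) U
  alternating_left : ∀ z ∈ U, ∀ I J, ∀ σ : Equiv.Perm (Fin p),
    α z (fun s => I (σ s)) J = ((Equiv.Perm.sign σ : ℤ) : ℂ) * α z I J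
  alternating_right : ∀ z ∈ U, ∀ I J, ∀ σ : Equiv.Perm (Fin q),
    α z I (fun s => J (σ s)) = ((Equiv.Perm.sign σ : ℤ) : ℂ) * α z I J

/-- A test form on `U`: a smooth form on `ℂⁿ` with compact support contained in `U`. -/
structure IsTestForm {n p q : ℕ} (U : Set (CSpace n)) (γ : CForm n p q) : Prop where
  form : IsSmoothForm Set.univ γ
  compact : ∀ I J, HasCompactSupport (fun z => γ z I J)
  support : ∀ I J, tsupport (fun z => γ z I J) ⊆ U

/-- The operator `∂ : Λ^{p,q} → Λ^{p+1,q}`. -/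
def del {n p q : ℕ} (α : CForm n p q) : CForm n (p + 1) q := fun z I J =>
  ∑ k : Fin (p + 1), (-1 : ℂ) ^ (k : ℕ) * dz (I k) (fun y => α y (fun s => I (k.succAbove s)) J) z

/-- The operator `∂̄ : Λ^{p,q} → Λ^{p,q+1}`; the sign `(-1)^p` moves `dz̄` past
the `p` factors `dz`. -/
def delbar {n p q : ℕ} (α : CForm n p q) : CForm n p (q + 1) := fun z I J =>
  (-1 : ℂ) ^ p * ∑ k : Fin (q + 1),
    (-1 : ℂ) ^ (k : ℕ) * dzbar (J k) (fun y => α y I (fun s => J (k.succAbove s))) z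

/-! ### Hermitian metrics in coordinates

A Hermitian metric is given in coordinates by the matrix function `G z j k = g_{j k̄}(z)`. -/

/-- `g^{k l̄}`, with `∑ₗ g_{j l̄} g^{k l̄} = δ_j^k`. -/
def gInv {n : ℕ} (G : CSpace n → Matrix (Fin n) (Fin n) ℂ) (z : CSpace n) (k l : Fin n) : ℂ :=
  (G z)⁻¹ l k

/-- Christoffel symbols of the Chern connection, `Γ_{ij}^k = g^{k l̄} ∂_i g_{j l̄}`. -/
def chernGamma {n : ℕ} (G : CSpace n → Matrix (Fin n) (Fin n) ℂ) (i j k : Fin n)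
    (z : CSpace n) : ℂ :=
  ∑ l, gInv G z k l * dz i (fun y => G y j l) z

/-- Torsion of the Chern connection, `T_{ij}^k = Γ_{ij}^k - Γ_{ji}^k`. -/
def torsionUp {n : ℕ} (G : CSpace n → Matrix (Fin n) (Fin n) ℂ) (i j k : Fin n)
    (z : CSpace n) : ℂ :=
  chernGamma G i j k z - chernGamma G j i k z

/-- `T_{i j k̄} = T_{ij}^l g_{l k̄}`. -/
def torsion {n : ℕ} (G : CSpace n → Matrix (Fin n) (Fin n) ℂ) (z : CSpace n)
    (i j k : Fin n) : ℂ :=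
  ∑ l, torsionUp G i j l z * G z l k

/-- `T_{ī j̄ k}`, the conjugate of `T_{i j k̄}`. -/
def torsionBar {n : ℕ} (G : CSpace n → Matrix (Fin n) (Fin n) ℂ) (z : CSpace n)
    (i j k : Fin n) : ℂ :=
  conj (torsion G z i j k)

/-- Curvature of the Chern connection, `Ω_{l m̄ j k̄} = - g_{p k̄} ∂_{m̄} Γ_{l j}^p`. -/
def chernCurvature {n : ℕ} (G : CSpace n → Matrix (Fin n) (Fin n) ℂ) (z : CSpace n)
    (l m j k : Fin n) : ℂ :=
  -∑ p, G z p k * dzbar m (chernGamma G l j p) z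

/-- `S_{j k̄} = g^{l m̄} Ω_{l m̄ j k̄}`. -/
def chernS {n : ℕ} (G : CSpace n → Matrix (Fin n) (Fin n) ℂ) (z : CSpace n) :
    Matrix (Fin n) (Fin n) ℂ := fun j k =>
  ∑ l, ∑ m, gInv G z l m * chernCurvature G z l m j k

/-- `Q¹_{i j̄} = g^{k l̄} g^{m n̄} T_{i k n̄} T_{j̄ l̄ m}`. -/
def Q1 {n : ℕ} (G : CSpace n → Matrix (Fin n) (Fin n) ℂ) (z : CSpace n) :
    Matrix (Fin n) (Fin n) ℂ := fun i j =>
  ∑ k, ∑ l, ∑ m, ∑ r, gInv G z k l * gInv G z m r * (torsion G z i k r * torsionBar G z j l m)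

/-- `Q²_{i j̄} = g^{k l̄} g^{m n̄} T_{l̄ n̄ i} T_{k m j̄}`. -/
def Q2 {n : ℕ} (G : CSpace n → Matrix (Fin n) (Fin n) ℂ) (z : CSpace n) :
    Matrix (Fin n) (Fin n) ℂ := fun i j =>
  ∑ k, ∑ l, ∑ m, ∑ r, gInv G z k l * gInv G z m r * (torsionBar G z l r i * torsion G z k m j)

/-- `Q³_{i j̄} = g^{k l̄} g^{m n̄} T_{i k l̄} T_{j̄ n̄ m}`. -/
def Q3 {n : ℕ} (G : CSpace n → Matrix (Fin n) (Fin n) ℂ) (z : CSpace n) :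
    Matrix (Fin n) (Fin n) ℂ := fun i j =>
  ∑ k, ∑ l, ∑ m, ∑ r, gInv G z k l * gInv G z m r * (torsion G z i k l * torsionBar G z j r m)

/-- `Q⁴_{i j̄} = ½ g^{k l̄} g^{m n̄} (T_{m k l̄} T_{n̄ j̄ i} + T_{n̄ l̄ k} T_{m i j̄})`. -/
def Q4 {n : ℕ} (G : CSpace n → Matrix (Fin n) (Fin n) ℂ) (z : CSpace n) :
    Matrix (Fin n) (Fin n) ℂ := fun i j =>
  (1 / 2 : ℂ) * ∑ k, ∑ l, ∑ m, ∑ r, gInv G z k l * gInv G z m r *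
    (torsion G z m k l * torsionBar G z r j i + torsionBar G z r l k * torsion G z m i j)

/-- `Q = ½ Q¹ - ¼ Q² - ½ Q³ + Q⁴`. -/
def Qtot {n : ℕ} (G : CSpace n → Matrix (Fin n) (Fin n) ℂ) (z : CSpace n) :
    Matrix (Fin n) (Fin n) ℂ :=
  (1 / 2 : ℂ) • Q1 G z - (1 / 4 : ℂ) • Q2 G z - (1 / 2 : ℂ) • Q3 G z + Q4 G z

/-! ### Real (1,1) tensors and their associated two-forms -/

/-- The real bilinear form `A(u,v) = Re ∑ A_{j k̄} uʲ v̄ᵏ` with Hermitian components `A_{j k̄}`. -/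
def realTensor {n : ℕ} (A : Matrix (Fin n) (Fin n) ℂ) (u v : CSpace n) : ℝ :=
  (∑ j, ∑ k, A j k * u j * conj (v k)).re

/-- The value `B(∂_j, ∂_{k̄})` of the complex bilinear extension of a real bilinear form `B`,
where `∂_j = ½ (e_j - √-1 J e_j)` and `∂_{k̄} = ½ (e_k + √-1 J e_k)`. -/
def complexEntry {n : ℕ} (B : CSpace n → CSpace n → ℝ) (j k : Fin n) : ℂ :=
  (1 / 4 : ℂ) *
    ((B (Pi.single j 1) (Pi.single k 1) : ℂ)
      + Complex.I * (B (Pi.single j 1) (Pi.single k Complex.I) : ℂ)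
      - Complex.I * (B (Pi.single j Complex.I) (Pi.single k 1) : ℂ)
      + (B (Pi.single j Complex.I) (Pi.single k Complex.I) : ℂ))

/-- The `(1,1)`-form `(u,v) ↦ - A(u, J v)` associated with a real `(1,1)` tensor `A`. -/
def assocForm {n : ℕ} (A : CSpace n → Matrix (Fin n) (Fin n) ℂ) : CForm n 1 1 := fun z I J =>
  complexEntry (fun u v => -realTensor (A z) u (Complex.I • v)) (I 0) (J 0)

/-- The `(1,1)`-form `(√-1/2) ∑ A_{j k̄} dzʲ ∧ dz̄ᵏ`. -/
def halfIForm {n : ℕ} (A : CSpace n → Matrix (Fin n) (Fin n) ℂ) : CForm n 1 1 := fun z I J =>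
  (Complex.I / 2) * A z (I 0) (J 0)

/-- The Kähler form `ω(u,v) = - g(u, J v)`. -/
def kahlerForm {n : ℕ} (G : CSpace n → Matrix (Fin n) (Fin n) ℂ) : CForm n 1 1 := assocForm G

/-- The `(1,1)`-form obtained from `S` in the way in which `ω` is obtained from `g`,
`Ξ(u,v) = - S(u, J v) = S(J u, v)`. -/
def Xi {n : ℕ} (G : CSpace n → Matrix (Fin n) (Fin n) ℂ) : CForm n 1 1 := assocForm (chernS G)

/-! ### Hodge operators -/

/-- Pointwise Hermitian inner product of `(p,q)`-forms, normalized by `⟨dzⁱ, dzʲ⟩ = g^{i j̄}`. -/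
def formInner {n p q : ℕ} (G : CSpace n → Matrix (Fin n) (Fin n) ℂ) (α β : CForm n p q)
    (z : CSpace n) : ℂ :=
  (1 / ((p.factorial : ℂ) * (q.factorial : ℂ))) *
    ∑ I : Fin p → Fin n, ∑ A : Fin p → Fin n, ∑ J : Fin q → Fin n, ∑ B : Fin q → Fin n,
      (∏ s, gInv G z (I s) (A s)) * (∏ s, gInv G z (B s) (J s)) * (α z I J * conj (β z A B))

/-- `L²` inner product over `U` for the volume form `ωⁿ/n! = det(g_{j k̄}) dLebesgue`. -/
def l2Inner {n p q : ℕ} (U : Set (CSpace n)) (G : CSpace n → Matrix (Fin n) (Fin n) ℂ)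
    (α β : CForm n p q) : ℂ :=
  ∫ z in U, formInner G α β z * (G z).det

/-- `η = D* β` on `U` for the `L²` inner product: `η` is a smooth form on `U` and
`(η, γ) = (β, D γ)` for all test forms `γ` on `U`. The operators are local and test forms on a
coordinate domain extend by zero, so that this determines the adjoint on a manifold as well. -/
structure IsL2Adjoint {n p q p' q' : ℕ} (U : Set (CSpace n))
    (G : CSpace n → Matrix (Fin n) (Fin n) ℂ) (D : CForm n p q → CForm n p' q')
    (β : CForm n p' q') (η : CForm n p q) : Prop where
  smooth : IsSmoothForm U η
  adjoint : ∀ γ : CForm n p q, IsTestForm U γ → l2Inner U G η γ = l2Inner U G β (D γ)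

/-- `D* β` exists on `U` and is unique there. -/
def HasUniqueL2Adjoint {n p q p' q' : ℕ} (U : Set (CSpace n))
    (G : CSpace n → Matrix (Fin n) (Fin n) ℂ) (D : CForm n p q → CForm n p' q')
    (β : CForm n p' q') : Prop :=
  (∃ η, IsL2Adjoint U G D β η) ∧
    ∀ η η', IsL2Adjoint U G D β η → IsL2Adjoint U G D β η' → Set.EqOn η η' U

open Classical in
/-- The `L²` adjoint `D* β` on `U` (zero if there is none). -/
def l2Adjoint {n p q p' q' : ℕ} (U : Set (CSpace n))
    (G : CSpace n → Matrix (Fin n) (Fin n) ℂ) (D : CForm n p q → CForm n p' q')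
    (β : CForm n p' q') : CForm n p q :=
  if h : ∃ η, IsL2Adjoint U G D β η then h.choose else 0

/-- The adjoint `∂*_g : Λ^{p+1,q} → Λ^{p,q}`. -/
def delStar {n p q : ℕ} (U : Set (CSpace n)) (G : CSpace n → Matrix (Fin n) (Fin n) ℂ)
    (β : CForm n (p + 1) q) : CForm n p q :=
  l2Adjoint U G del β

/-- The adjoint `∂̄*_g : Λ^{p,q+1} → Λ^{p,q}`. -/
def delbarStar {n p q : ℕ} (U : Set (CSpace n)) (G : CSpace n → Matrix (Fin n) (Fin n) ℂ)
    (β : CForm n p (q + 1)) : CForm n p q :=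
  l2Adjoint U G delbar β

/-- Contraction of a `(1,2)`-form with a `(1,0)`-form by the metric, in the first antiholomorphic
index: `(α ⌟ β)_{j k̄} = g^{p q̄} α_p β_{j q̄ k̄}`. -/
def hook {n : ℕ} (G : CSpace n → Matrix (Fin n) (Fin n) ℂ) (α : CForm n 1 0)
    (β : CForm n 1 2) : CForm n 1 1 := fun z I J =>
  ∑ p, ∑ q, gInv G z p q * α z ![p] ![] * β z I ![q, J 0]

/-- The function `log det g`. -/
def logDet {n : ℕ} (G : CSpace n → Matrix (Fin n) (Fin n) ℂ) : CForm n 0 0 := fun z _ _ =>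
  (Real.log (G z).det.re : ℂ)

/-- `Ψ(ω) = ∂*∂ω - ∂∂*ω - (√-1/2) ∂∂̄ log det g - 2√-1 (∂̄*ω ⌟ ∂̄ω)`. -/
def Psi {n : ℕ} (U : Set (CSpace n)) (G : CSpace n → Matrix (Fin n) (Fin n) ℂ) : CForm n 1 1 :=
  delStar U G (del (kahlerForm G)) - del (delStar U G (kahlerForm G))
    - (Complex.I / 2) • del (delbar (logDet G))
    - (2 * Complex.I) • hook G (delbarStar U G (kahlerForm G)) (delbar (kahlerForm G))

/-! ### Hermitian metrics on complex manifolds -/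

/-- Differential at `z` of the inverse of a holomorphic chart. -/
def chartVec {n : ℕ} {M : Type*} [TopologicalSpace M] [ChartedSpace (CSpace n) M]
    (φ : OpenPartialHomeomorph M (CSpace n)) (z : CSpace n) (u : CSpace n) :
    TangentSpace 𝓘(ℂ, CSpace n) (φ.symm z) :=
  mfderiv 𝓘(ℂ, CSpace n) 𝓘(ℂ, CSpace n) φ.symm z u

/-- A smooth Hermitian metric: a Riemannian metric `g` with `g(Ju, Jv) = g(u, v)`, where `J` is
multiplication by `√-1` on the tangent spaces of the complex manifold `M`. -/
structure HermitianMetric (n : ℕ) (M : Type*) [TopologicalSpace M] [ChartedSpace (CSpace n) M] where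
  val : ∀ x : M, TangentSpace 𝓘(ℂ, CSpace n) x → TangentSpace 𝓘(ℂ, CSpace n) x → ℝ
  add_left : ∀ x u u' v, val x (u + u') v = val x u v + val x u' v
  smul_left : ∀ x (c : ℝ) u v, val x ((c : ℂ) • u) v = c * val x u v
  symm : ∀ x u v, val x u v = val x v u
  pos : ∀ x u, u ≠ 0 → 0 < val x u u
  J_invariant : ∀ x u v, val x (Complex.I • u) (Complex.I • v) = val x u v
  smooth : ∀ φ ∈ IsManifold.maximalAtlas 𝓘(ℂ, CSpace n) ω M, ∀ u v : CSpace n,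
    ContDiffOn ℝ ∞ (fun z => val (φ.symm z) (chartVec φ z u) (chartVec φ z v)) φ.target

/-- Components in a chart, `g_{j k̄} = g(∂/∂xʲ, ∂/∂xᵏ) + √-1 g(∂/∂xʲ, J ∂/∂xᵏ)`; equivalently
`g(u,v) = Re ∑ g_{j k̄} uʲ v̄ᵏ`. This is the normalization with `ω = (√-1/2) g_{j k̄} dzʲ ∧ dz̄ᵏ`. -/
def HermitianMetric.comp {n : ℕ} {M : Type*} [TopologicalSpace M] [ChartedSpace (CSpace n) M]
    (g : HermitianMetric n M) (φ : OpenPartialHomeomorph M (CSpace n)) (z : CSpace n) :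
    Matrix (Fin n) (Fin n) ℂ := fun j k =>
  (g.val (φ.symm z) (chartVec φ z (Pi.single j 1)) (chartVec φ z (Pi.single k 1)) : ℂ)
    + Complex.I *
      (g.val (φ.symm z) (chartVec φ z (Pi.single j 1)) (chartVec φ z (Pi.single k Complex.I)) : ℂ)

/-- The equation `∂g/∂t = - S + Q` of Hermitian curvature flow for times `t ∈ D`, written in all
holomorphic charts. -/
def IsHCF {n : ℕ} {M : Type*} [TopologicalSpace M] [ChartedSpace (CSpace n) M]
    (D : Set ℝ) (g : ℝ → HermitianMetric n M) : Prop :=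
  ∀ t ∈ D, ∀ φ ∈ IsManifold.maximalAtlas 𝓘(ℂ, CSpace n) ω M, ∀ z ∈ φ.target, ∀ j k : Fin n,
    HasDerivWithinAt (fun s => (g s).comp φ z j k)
      (-chernS ((g t).comp φ) z j k + Qtot ((g t).comp φ) z j k) D t

end HermitianFlow

end

noncomputable section

namespace HermitianFlow

variable {n : ℕ}

/-! Everything is local. In a holomorphic chart the metric is a smooth field `G` of positive
definite Hermitian matrices on an open set, and both claims follow from one pointwise identity,
`Psi_eq`: `Ψ = (√-1/2)(S + ½ Q² - 2 Q⁴)`. The first claim is a rearrangement of it. In the second,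
substituting it turns the right-hand side into `√-1/2` times `-S + Q`, and the nonzero constant
`√-1/2` can be multiplied in or divided out under the time derivative.

The adjoints are found by integration by parts against test forms. Conjugating the test form
exchanges `∂_a` and `∂_ā`, so the derivative falls on the raised components of the form times `det
g`. With Jacobi's formula and the derivative of the inverse matrix, the divergence of `g^{b ā} det
g` is `det g` times the raised torsion trace. Writing `τ` for `trTorsion` and `τ̄` for
`trTorsionBar`, this gives `∂*ω = -(√-1/2) τ̄` and `∂̄*ω = (√-1/2) τ`. For `∂*∂ω` it gives a trace
of the derivative of the torsion corrected by metric terms (`torsionDeriv`), minus a `τ̄ T` term.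
Testing against forms dual to a single component shows that these answers are the only ones.

For the identity itself, `τ̄_k = ∂_{k̄} log det g - g^{p q̄} ∂_{q̄} g_{p k̄}`, so the `log det` term
of `Ψ` removes the logarithmic part of `-∂∂*ω`. The remaining second derivatives `∂_{m̄} ∂_j g_{a
k̄}` cancel those coming from `∂*∂ω`. What is left is `S` (`chernS_eq`), one product of `∂̄g` with
torsion that is half of `Q²` by antisymmetry (`Q2_eq`), and two products of a torsion trace with
torsion, one from `∂*∂ω` and one from the contraction term, which together form `2 Q⁴` (`Q4_eq`). -/

/-! ### First order differential operators with constant coefficients -/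

/-- Complex first order operators `a ∂_v + b ∂_w`, a class that contains `∂/∂zⁱ` and `∂/∂z̄ⁱ`. -/
def IsFirstOrder (D : (CSpace n → ℂ) → CSpace n → ℂ) : Prop :=
  ∃ (a b : ℂ) (v w : CSpace n), ∀ f z, D f z = a * fderiv ℝ f z v + b * fderiv ℝ f z w

theorem isFirstOrder_dz (i : Fin n) : IsFirstOrder (dz i) :=
  ⟨1 / 2, -(1 / 2 * Complex.I), Pi.single i 1, Pi.single i Complex.I, fun f z => by
    simp only [dz]; ring⟩

theorem isFirstOrder_dzbar (i : Fin n) : IsFirstOrder (dzbar i) :=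
  ⟨1 / 2, 1 / 2 * Complex.I, Pi.single i 1, Pi.single i Complex.I, fun f z => by
    simp only [dzbar]; ring⟩

namespace IsFirstOrder

variable {D E : (CSpace n → ℂ) → CSpace n → ℂ} {f h : CSpace n → ℂ} {z : CSpace n}
  {U : Set (CSpace n)}

theorem congr (hD : IsFirstOrder D) (hfh : f =ᶠ[nhds z] h) : D f z = D h z := by
  obtain ⟨a, b, v, w, H⟩ := hD
  rw [H, H, hfh.fderiv_eq]

theorem congr_on (hD : IsFirstOrder D) (hU : IsOpen U) (hfh : Set.EqOn f h U) (hz : z ∈ U) :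
    D f z = D h z :=
  hD.congr (hfh.eventuallyEq_of_mem (hU.mem_nhds hz))

theorem const (hD : IsFirstOrder D) (c : ℂ) : D (fun _ => c) z = 0 := by
  obtain ⟨a, b, v, w, H⟩ := hD
  simp [H]

theorem sub (hD : IsFirstOrder D) (hf : DifferentiableAt ℝ f z) (hh : DifferentiableAt ℝ h z) :
    D (fun y => f y - h y) z = D f z - D h z := by
  obtain ⟨a, b, v, w, H⟩ := hD
  simp only [H, fderiv_fun_sub hf hh, sub_apply]
  ring

theorem mul (hD : IsFirstOrder D) (hf : DifferentiableAt ℝ f z) (hh : DifferentiableAt ℝ h z) :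
    D (fun y => f y * h y) z = D f z * h z + f z * D h z := by
  obtain ⟨a, b, v, w, H⟩ := hD
  simp only [H, fderiv_fun_mul hf hh, add_apply, smul_apply,
    smul_eq_mul]
  ring

theorem const_mul (hD : IsFirstOrder D) (c : ℂ) (hf : DifferentiableAt ℝ f z) :
    D (fun y => c * f y) z = c * D f z := by
  rw [hD.mul (differentiableAt_const c) hf, hD.const, zero_mul, zero_add]

theorem sum (hD : IsFirstOrder D) {ι : Type*} (s : Finset ι) {F : ι → CSpace n → ℂ}
    (hF : ∀ i ∈ s, DifferentiableAt ℝ (F i) z) :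
    D (fun y => ∑ i ∈ s, F i y) z = ∑ i ∈ s, D (F i) z := by
  obtain ⟨a, b, v, w, H⟩ := hD
  simp only [H, fderiv_fun_sum hF, sum_apply, Finset.mul_sum,
    Finset.sum_add_distrib]

theorem contDiffOn (hD : IsFirstOrder D) (hU : IsOpen U) (hf : ContDiffOn ℝ ∞ f U) :
    ContDiffOn ℝ ∞ (D f) U := by
  obtain ⟨a, b, v, w, H⟩ := hD
  rw [show D f = fun z => a * fderiv ℝ f z v + b * fderiv ℝ f z w from funext (H f)]
  have h := hf.fderiv_of_isOpen hU (m := ∞) (by simp)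
  exact (contDiffOn_const.mul (h.clm_apply contDiffOn_const)).add
    (contDiffOn_const.mul (h.clm_apply contDiffOn_const))

theorem contDiff (hD : IsFirstOrder D) (hf : ContDiff ℝ ∞ f) : ContDiff ℝ ∞ (D f) :=
  contDiffOn_univ.1 (hD.contDiffOn isOpen_univ hf.contDiffOn)

theorem support_subset (hD : IsFirstOrder D) : Function.support (D f) ⊆ tsupport f := by
  intro x hx
  by_contra hxf
  apply hx
  obtain ⟨a, b, v, w, H⟩ := hD
  have : fderiv ℝ f x = 0 := by
    by_contra h0
    exact hxf (support_fderiv_subset ℝ h0)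
  simp [H, this]

theorem comm (hD : IsFirstOrder D) (hE : IsFirstOrder E) (hU : IsOpen U)
    (hf : ContDiffOn ℝ ∞ f U) (hz : z ∈ U) : D (E f) z = E (D f) z := by
  obtain ⟨a, b, v, w, H⟩ := hD
  obtain ⟨a', b', v', w', H'⟩ := hE
  have hd : DifferentiableAt ℝ (fderiv ℝ f) z :=
    ((hf.fderiv_of_isOpen hU (m := ∞) (by simp)).contDiffAt (hU.mem_nhds hz)).differentiableAt
      (by simp)
  have hs : IsSymmSndFDerivAt ℝ f z :=
    (hf.contDiffAt (hU.mem_nhds hz)).isSymmSndFDerivAt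
      (by simpa using WithTop.coe_le_coe.2 (le_top (a := (2 : ℕ∞))))
  have key : ∀ (c d : ℂ) (x y u : CSpace n),
      fderiv ℝ (fun p => c * fderiv ℝ f p x + d * fderiv ℝ f p y) z u
        = c * fderiv ℝ (fderiv ℝ f) z u x + d * fderiv ℝ (fderiv ℝ f) z u y := by
    intro c d x y u
    have e : ∀ x : CSpace n, DifferentiableAt ℝ (fun p => fderiv ℝ f p x) z :=
      fun x => hd.clm_apply (differentiableAt_const x)
    have e' : ∀ x : CSpace n, fderiv ℝ (fun p => fderiv ℝ f p x) z u
        = fderiv ℝ (fderiv ℝ f) z u x := by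
      intro x
      rw [fderiv_clm_apply hd (differentiableAt_const x)]
      simp
    rw [fderiv_fun_add ((e x).const_mul c) ((e y).const_mul d), fderiv_const_mul (e x),
      fderiv_const_mul (e y)]
    simp [e']
  rw [H, H', show E f = fun p => a' * fderiv ℝ f p v' + b' * fderiv ℝ f p w' from funext (H' f),
    show D f = fun p => a * fderiv ℝ f p v + b * fderiv ℝ f p w from funext (H f)]
  simp only [key, hs.eq v v', hs.eq v w', hs.eq w v', hs.eq w w']
  ring

/-- Jacobi's formula: the determinant is multilinear in the rows, so its derivative is a sum of
determinants with one row replaced, and Cramer's rule expresses each through the adjugate. -/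
theorem det (hD : IsFirstOrder D) {F : CSpace n → Matrix (Fin n) (Fin n) ℂ}
    (hF : ∀ i j, DifferentiableAt ℝ (fun y => F y i j) z) :
    D (fun y => (F y).det) z = ∑ i, ∑ j, (F z).adjugate j i * D (fun y => F y i j) z := by
  obtain ⟨a, b, v, w, H⟩ := hD
  have key : ∀ u, fderiv ℝ (fun y => (F y).det) z u
      = ∑ i, ∑ j, (F z).adjugate j i * fderiv ℝ (fun y => F y i j) z u := by
    intro u
    let m : ContinuousMultilinearMap ℝ (fun _ : Fin n => (Fin n → ℂ)) ℂ :=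
      { toMultilinearMap :=
          (Matrix.detRowAlternating (n := Fin n) (R := ℂ)).toMultilinearMap.restrictScalars ℝ
        cont := by
          change Continuous fun M : Matrix (Fin n) (Fin n) ℂ => M.det
          exact continuous_id.matrix_det }
    let R : CSpace n → Fin n → Fin n → ℂ := fun y i j => F y i j
    have hR : HasFDerivAt R (ContinuousLinearMap.pi fun i => ContinuousLinearMap.pi fun j =>
        fderiv ℝ (fun y => F y i j) z) z :=
      hasFDerivAt_pi.2 fun i => hasFDerivAt_pi.2 fun j => (hF i j).hasFDerivAt
    have h1 : HasFDerivAt (fun y => (F y).det) _ z := (m.hasFDerivAt (R z)).comp z hR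
    rw [h1.fderiv, ContinuousLinearMap.comp_apply, ContinuousMultilinearMap.linearDeriv_apply]
    refine Finset.sum_congr rfl fun i _ => ?_
    change ((F z).updateRow i fun j => fderiv ℝ (fun y => F y i j) z u).det = _
    rw [← Matrix.cramer_transpose_apply, Matrix.cramer_eq_adjugate_mulVec,
      ← Matrix.adjugate_transpose]
    rfl
  simp only [H, key, Finset.mul_sum, ← Finset.sum_add_distrib]
  refine Finset.sum_congr rfl fun i _ => Finset.sum_congr rfl fun j _ => ?_
  ring

theorem integral_eq_zero (hD : IsFirstOrder D) (hf : ContDiff ℝ ∞ f) (hc : HasCompactSupport f) :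
    ∫ z, D f z = 0 := by
  have key : ∀ u, Integrable (fun z => fderiv ℝ f z u) ∧ ∫ z, fderiv ℝ f z u = 0 := by
    intro u
    have hi : Integrable (fun z => fderiv ℝ f z u) :=
      ((hf.continuous_fderiv (by simp)).clm_apply continuous_const).integrable_of_hasCompactSupport
        (hc.fderiv_apply ℝ u)
    refine ⟨hi, ?_⟩
    -- Integration by parts against the constant function 1.
    have := integral_mul_fderiv_eq_neg_fderiv_mul_of_integrable (𝕜 := ℂ) (μ := volume)
      (f := fun _ : CSpace n => (1 : ℂ)) (g := f) (v := u) (by simp) (by simpa using hi)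
      (by simpa using hf.continuous.integrable_of_hasCompactSupport hc)
      (fun _ _ => differentiableAt_const _)
      (fun _ _ => hf.differentiable (by simp) _)
    simpa using this
  obtain ⟨a, b, v, w, H⟩ := hD
  simp only [H]
  rw [integral_add ((key v).1.const_mul a) ((key w).1.const_mul b), integral_const_mul,
    integral_const_mul, (key v).2, (key w).2]
  simp

end IsFirstOrder

theorem conj_dz (i : Fin n) {f : CSpace n → ℂ} {z : CSpace n} (hf : DifferentiableAt ℝ f z) :
    conj (dz i f z) = dzbar i (fun y => conj (f y)) z := by
  have h : ∀ u, fderiv ℝ (fun y => conj (f y)) z u = conj (fderiv ℝ f z u) := by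
    intro u
    have := (Complex.conjCLE.toContinuousLinearMap.hasFDerivAt.comp z hf.hasFDerivAt).fderiv
    change fderiv ℝ (Complex.conjCLE ∘ f) z u = _
    rw [show fderiv ℝ (Complex.conjCLE ∘ f) z = _ from this]
    rfl
  simp only [dz, dzbar, h, map_mul, map_sub, map_div₀, map_one, Complex.conj_I, map_ofNat]
  ring

theorem conj_dzbar (i : Fin n) {f : CSpace n → ℂ} {z : CSpace n} (hf : DifferentiableAt ℝ f z) :
    conj (dzbar i f z) = dz i (fun y => conj (f y)) z := by
  have hf' : DifferentiableAt ℝ (fun y => conj (f y)) z :=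
    Complex.conjCLE.differentiableAt.comp z hf
  have := conj_dz i hf'
  simp only [Complex.conj_conj] at this
  rw [← this, Complex.conj_conj]

/-! ### Hermitian matrix functions on a coordinate domain -/

open scoped ComplexOrder in
/-- A smooth field of positive definite Hermitian matrices on an open set. -/
structure IsMetricOn (U : Set (CSpace n)) (G : CSpace n → Matrix (Fin n) (Fin n) ℂ) : Prop where
  isOpen : IsOpen U
  smooth : ∀ j k, ContDiffOn ℝ ∞ (fun z => G z j k) U
  posDef : ∀ z ∈ U, (G z).PosDef

/-- Entrywise application of a differential operator to a matrix function. -/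
def matD (D : (CSpace n → ℂ) → CSpace n → ℂ) (F : CSpace n → Matrix (Fin n) (Fin n) ℂ)
    (z : CSpace n) : Matrix (Fin n) (Fin n) ℂ := fun j k => D (fun y => F y j k) z

section MatD

variable {D : (CSpace n → ℂ) → CSpace n → ℂ} {F H : CSpace n → Matrix (Fin n) (Fin n) ℂ}
  {z : CSpace n}

theorem matD_mul (hD : IsFirstOrder D) (hF : ∀ j k, DifferentiableAt ℝ (fun y => F y j k) z)
    (hH : ∀ j k, DifferentiableAt ℝ (fun y => H y j k) z) :
    matD D (fun y => F y * H y) z = matD D F z * H z + F z * matD D H z := by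
  ext j k
  simp only [matD, Matrix.mul_apply, Matrix.add_apply]
  rw [hD.sum _ fun i _ => (hF j i).fun_mul (hH i k), ← Finset.sum_add_distrib]
  exact Finset.sum_congr rfl fun i _ => hD.mul (hF j i) (hH i k)

theorem differentiableAt_matrix_mul (hF : ∀ j k, DifferentiableAt ℝ (fun y => F y j k) z)
    (hH : ∀ j k, DifferentiableAt ℝ (fun y => H y j k) z) (j k : Fin n) :
    DifferentiableAt ℝ (fun y => (F y * H y) j k) z := by
  simp only [Matrix.mul_apply]
  exact DifferentiableAt.fun_sum fun i _ => (hF j i).mul (hH i k)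

end MatD

theorem contDiffOn_det {U : Set (CSpace n)} {F : CSpace n → Matrix (Fin n) (Fin n) ℂ}
    (hF : ∀ j k, ContDiffOn ℝ ∞ (fun z => F z j k) U) :
    ContDiffOn ℝ ∞ (fun z => (F z).det) U := by
  simp only [Matrix.det_apply']
  exact ContDiffOn.sum fun σ _ => contDiffOn_const.mul (contDiffOn_prod fun i _ => hF _ _)

/-- `∑ g^{k l̄} T_{i k l̄}`. -/
def trTorsion (G : CSpace n → Matrix (Fin n) (Fin n) ℂ) (z : CSpace n) (i : Fin n) : ℂ :=
  ∑ k, ∑ l, gInv G z k l * torsion G z i k l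

/-- `∑ g^{k l̄} T_{j̄ l̄ k}`. -/
def trTorsionBar (G : CSpace n → Matrix (Fin n) (Fin n) ℂ) (z : CSpace n) (j : Fin n) : ℂ :=
  ∑ k, ∑ l, gInv G z k l * torsionBar G z j l k

namespace IsMetricOn

variable {U : Set (CSpace n)} {G : CSpace n → Matrix (Fin n) (Fin n) ℂ} {z : CSpace n}
  {D : (CSpace n → ℂ) → CSpace n → ℂ}

theorem differentiableAt (hG : IsMetricOn U G) (hz : z ∈ U) {f : CSpace n → ℂ}
    (hf : ContDiffOn ℝ ∞ f U) : DifferentiableAt ℝ f z :=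
  (hf.contDiffAt (hG.isOpen.mem_nhds hz)).differentiableAt (by simp)

open scoped ComplexOrder in
theorem det_ne_zero (hG : IsMetricOn U G) (hz : z ∈ U) : (G z).det ≠ 0 :=
  (hG.posDef z hz).det_pos.ne'

theorem isUnit_det (hG : IsMetricOn U G) (hz : z ∈ U) : IsUnit (G z).det :=
  (hG.det_ne_zero hz).isUnit

open scoped ComplexOrder in
theorem isHermitian (hG : IsMetricOn U G) (hz : z ∈ U) : (G z).IsHermitian :=
  (hG.posDef z hz).isHermitian

theorem conj_apply (hG : IsMetricOn U G) (hz : z ∈ U) (j k : Fin n) :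
    conj (G z j k) = G z k j :=
  (hG.isHermitian hz).apply k j

theorem contDiffOn_det (hG : IsMetricOn U G) : ContDiffOn ℝ ∞ (fun z => (G z).det) U :=
  HermitianFlow.contDiffOn_det hG.smooth

theorem contDiffOn_gInv (hG : IsMetricOn U G) (k l : Fin n) :
    ContDiffOn ℝ ∞ (fun z => gInv G z k l) U := by
  -- Cramer's rule reduces smoothness of the inverse to smoothness of determinants.
  have h : ∀ z, gInv G z k l = (G z).det⁻¹ * ((G z).updateRow k (Pi.single l 1)).det := by
    intro z
    rw [gInv, Matrix.inv_def, Matrix.smul_apply, Matrix.adjugate_apply, Ring.inverse_eq_inv',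
      smul_eq_mul]
  simp only [h]
  refine (hG.contDiffOn_det.inv fun z hz => hG.det_ne_zero hz).mul
    (HermitianFlow.contDiffOn_det fun i j => ?_)
  by_cases hi : i = k
  · subst hi
    simpa using contDiffOn_const
  · simpa [Matrix.updateRow_ne hi] using hG.smooth i j

theorem sum_gInv_mul (hG : IsMetricOn U G) (hz : z ∈ U) (j k : Fin n) :
    ∑ l, gInv G z k l * G z j l = if j = k then 1 else 0 := by
  have := congrFun₂ (Matrix.mul_nonsing_inv (G z) (hG.isUnit_det hz)) j k
  rw [Matrix.mul_apply, Matrix.one_apply] at this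
  rw [← this]
  exact Finset.sum_congr rfl fun l _ => mul_comm _ _

theorem sum_gInv_mul' (hG : IsMetricOn U G) (hz : z ∈ U) (j k : Fin n) :
    ∑ l, gInv G z l k * G z l j = if j = k then 1 else 0 := by
  have := congrFun₂ (Matrix.nonsing_inv_mul (G z) (hG.isUnit_det hz)) k j
  rw [Matrix.mul_apply, Matrix.one_apply] at this
  simp only [gInv, this, eq_comm]

/-- Differentiate `G * G⁻¹ = 1`, which holds on the whole open set `U`. -/
theorem matD_inv (hG : IsMetricOn U G) (hD : IsFirstOrder D) (hz : z ∈ U) :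
    matD D (fun y => (G y)⁻¹) z = -((G z)⁻¹ * matD D G z * (G z)⁻¹) := by
  have h1 : matD D (fun y => G y * (G y)⁻¹) z = 0 := by
    ext j k
    rw [matD, hD.congr_on hG.isOpen (h := fun _ => (1 : Matrix (Fin n) (Fin n) ℂ) j k) _ hz,
      hD.const]
    · rfl
    · intro y hy
      simp only [Matrix.mul_nonsing_inv (G y) (hG.isUnit_det hy)]
  rw [matD_mul (H := fun y => (G y)⁻¹) hD (fun j k => hG.differentiableAt hz (hG.smooth j k))
    (fun j k => hG.differentiableAt hz (hG.contDiffOn_gInv k j))] at h1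
  have h2 := congrArg (fun X => (G z)⁻¹ * X) (eq_neg_of_add_eq_zero_right h1)
  simpa only [← mul_assoc, Matrix.nonsing_inv_mul (G z) (hG.isUnit_det hz), one_mul, mul_neg]
    using h2

theorem deriv_gInv (hG : IsMetricOn U G) (hD : IsFirstOrder D) (hz : z ∈ U) (p q : Fin n) :
    D (fun y => gInv G y p q) z
      = -∑ m, ∑ r, gInv G z p r * gInv G z m q * D (fun y => G y m r) z := by
  have := congrFun₂ (hG.matD_inv hD hz) q p
  rw [Matrix.neg_apply, Matrix.mul_apply] at this
  simp only [Matrix.mul_apply, Finset.sum_mul] at this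
  rw [Finset.sum_comm] at this
  refine this.trans (congrArg _ (Finset.sum_congr rfl fun m _ => Finset.sum_congr rfl fun r _ => ?_))
  simp only [gInv, matD]
  ring

theorem deriv_det (hG : IsMetricOn U G) (hD : IsFirstOrder D) (hz : z ∈ U) :
    D (fun y => (G y).det) z
      = (G z).det * ∑ p, ∑ q, gInv G z p q * D (fun y => G y p q) z := by
  rw [hD.det fun j k => hG.differentiableAt hz (hG.smooth j k)]
  simp only [Finset.mul_sum]
  refine Finset.sum_congr rfl fun p _ => Finset.sum_congr rfl fun q _ => ?_
  have : (G z).adjugate = (G z).det • (G z)⁻¹ := by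
    rw [Matrix.inv_def, smul_smul, Ring.mul_inverse_cancel _ (hG.isUnit_det hz), one_smul]
  rw [this, Matrix.smul_apply, smul_eq_mul, gInv]
  ring

/-- Lowering the upper index cancels the inverse metric in `Γ`, so the lowered torsion involves only
first derivatives of `g`. -/
theorem torsion_eq (hG : IsMetricOn U G) (hz : z ∈ U) (i j k : Fin n) :
    torsion G z i j k = dz i (fun y => G y j k) z - dz j (fun y => G y i k) z := by
  have key : ∀ a b, ∑ l, chernGamma G a b l z * G z l k = dz a (fun y => G y b k) z := by
    intro a b
    simp only [chernGamma, Finset.sum_mul]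
    rw [Finset.sum_comm]
    calc _ = ∑ q, dz a (fun y => G y b q) z * ∑ l, gInv G z l q * G z l k := by
          refine Finset.sum_congr rfl fun q _ => ?_
          rw [Finset.mul_sum]
          exact Finset.sum_congr rfl fun l _ => by ring
      _ = _ := by simp [hG.sum_gInv_mul' hz]
  simp only [torsion, torsionUp, sub_mul, Finset.sum_sub_distrib, key]

theorem torsionBar_eq (hG : IsMetricOn U G) (hz : z ∈ U) (i j k : Fin n) :
    torsionBar G z i j k = dzbar i (fun y => G y k j) z - dzbar j (fun y => G y k i) z := by
  have key : ∀ a b, conj (dz a (fun y => G y b k) z) = dzbar a (fun y => G y k b) z := by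
    intro a b
    rw [conj_dz a (hG.differentiableAt hz (hG.smooth b k))]
    exact (isFirstOrder_dzbar a).congr_on hG.isOpen (fun y hy => hG.conj_apply hy b k) hz
  rw [torsionBar, hG.torsion_eq hz, map_sub, key, key]

theorem contDiffOn_torsion (hG : IsMetricOn U G) (i j k : Fin n) :
    ContDiffOn ℝ ∞ (fun z => torsion G z i j k) U :=
  ContDiffOn.congr (((isFirstOrder_dz i).contDiffOn hG.isOpen (hG.smooth j k)).sub
    ((isFirstOrder_dz j).contDiffOn hG.isOpen (hG.smooth i k))) fun _ hz => hG.torsion_eq hz i j k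

theorem contDiffOn_torsionBar (hG : IsMetricOn U G) (i j k : Fin n) :
    ContDiffOn ℝ ∞ (fun z => torsionBar G z i j k) U :=
  ContDiffOn.congr (((isFirstOrder_dzbar i).contDiffOn hG.isOpen (hG.smooth k j)).sub
    ((isFirstOrder_dzbar j).contDiffOn hG.isOpen (hG.smooth k i)))
    fun _ hz => hG.torsionBar_eq hz i j k

theorem contDiffOn_trTorsion (hG : IsMetricOn U G) (i : Fin n) :
    ContDiffOn ℝ ∞ (fun z => trTorsion G z i) U :=
  ContDiffOn.sum fun k _ => ContDiffOn.sum fun l _ =>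
    (hG.contDiffOn_gInv k l).mul (hG.contDiffOn_torsion i k l)

theorem contDiffOn_trTorsionBar (hG : IsMetricOn U G) (i : Fin n) :
    ContDiffOn ℝ ∞ (fun z => trTorsionBar G z i) U :=
  ContDiffOn.sum fun k _ => ContDiffOn.sum fun l _ =>
    (hG.contDiffOn_gInv k l).mul (hG.contDiffOn_torsionBar i l k)

/-- `∑ ∂_{ā} (g^{b ā} det g) = det g ∑ g^{b ā} τ_{ā}`. -/
theorem sum_dzbar_gInv_mul_det (hG : IsMetricOn U G) (hz : z ∈ U) (b : Fin n) :
    ∑ a, dzbar a (fun y => gInv G y b a * (G y).det) z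
      = (G z).det * ∑ a, gInv G z b a * trTorsionBar G z a := by
  -- The derivative of the determinant supplies one half of the torsion trace; that of the inverse
  -- supplies the other half, up to relabelling the summation indices.
  have h : ∀ a, dzbar a (fun y => gInv G y b a * (G y).det) z
      = (G z).det * ((∑ p, ∑ q, gInv G z b a * gInv G z p q * dzbar a (fun y => G y p q) z)
        - ∑ p, ∑ q, gInv G z b q * gInv G z p a * dzbar a (fun y => G y p q) z) := by
    intro a
    rw [(isFirstOrder_dzbar a).mul (hG.differentiableAt hz (hG.contDiffOn_gInv b a))
      (hG.differentiableAt hz hG.contDiffOn_det), hG.deriv_gInv (isFirstOrder_dzbar a) hz,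
      hG.deriv_det (isFirstOrder_dzbar a) hz]
    simp only [mul_assoc, ← Finset.mul_sum]
    ring
  have h' : ∀ a, gInv G z b a * trTorsionBar G z a
      = (∑ p, ∑ q, gInv G z b a * gInv G z p q * dzbar a (fun y => G y p q) z)
        - ∑ p, ∑ q, gInv G z b a * gInv G z p q * dzbar q (fun y => G y p a) z := by
    intro a
    simp only [trTorsionBar, hG.torsionBar_eq hz, mul_sub, Finset.sum_sub_distrib, Finset.mul_sum,
      mul_assoc]
  simp only [h, h', ← Finset.mul_sum, Finset.sum_sub_distrib]
  congr 2
  rw [Finset.sum_comm]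
  conv_rhs => rw [Finset.sum_comm]
  exact Finset.sum_congr rfl fun p _ => Finset.sum_comm

/-- `∑ ∂_b (g^{b ā} det g) = det g ∑ g^{b ā} τ_b`. -/
theorem sum_dz_gInv_mul_det (hG : IsMetricOn U G) (hz : z ∈ U) (a : Fin n) :
    ∑ b, dz b (fun y => gInv G y b a * (G y).det) z
      = (G z).det * ∑ b, gInv G z b a * trTorsion G z b := by
  have h : ∀ b, dz b (fun y => gInv G y b a * (G y).det) z
      = (G z).det * ((∑ p, ∑ q, gInv G z b a * gInv G z p q * dz b (fun y => G y p q) z)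
        - ∑ p, ∑ q, gInv G z b q * gInv G z p a * dz b (fun y => G y p q) z) := by
    intro b
    rw [(isFirstOrder_dz b).mul (hG.differentiableAt hz (hG.contDiffOn_gInv b a))
      (hG.differentiableAt hz hG.contDiffOn_det), hG.deriv_gInv (isFirstOrder_dz b) hz,
      hG.deriv_det (isFirstOrder_dz b) hz]
    simp only [mul_assoc, ← Finset.mul_sum]
    ring
  have h' : ∀ b, gInv G z b a * trTorsion G z b
      = (∑ p, ∑ q, gInv G z b a * gInv G z p q * dz b (fun y => G y p q) z)
        - ∑ p, ∑ q, gInv G z b a * gInv G z p q * dz p (fun y => G y b q) z := by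
    intro b
    simp only [trTorsion, hG.torsion_eq hz, mul_sub, Finset.sum_sub_distrib, Finset.mul_sum,
      mul_assoc]
  simp only [h, h', ← Finset.mul_sum, Finset.sum_sub_distrib]
  congr 2
  rw [Finset.sum_comm]
  exact Finset.sum_congr rfl fun p _ => Finset.sum_congr rfl fun b _ =>
    Finset.sum_congr rfl fun q _ => by rw [mul_comm (gInv G z b q)]

end IsMetricOn

/-! ### Integration against test functions -/

/-- A smooth function with compact support contained in `U`. -/
structure IsTestFunction (U : Set (CSpace n)) (f : CSpace n → ℂ) : Prop where
  contDiff : ContDiff ℝ ∞ f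
  compact : HasCompactSupport f
  support : tsupport f ⊆ U

namespace IsTestFunction

variable {U : Set (CSpace n)} {f F : CSpace n → ℂ} {D : (CSpace n → ℂ) → CSpace n → ℂ}

theorem comp_conj (hf : IsTestFunction U f) : IsTestFunction U fun z => conj (f z) where
  contDiff := Complex.conjCLE.contDiff.comp hf.contDiff
  compact := hf.compact.comp_left (g := fun w : ℂ => (starRingEnd ℂ) w) (map_zero _)
  support := (tsupport_comp_subset (g := fun w : ℂ => (starRingEnd ℂ) w) (map_zero _) f).trans
    hf.support

theorem deriv (hf : IsTestFunction U f) (hD : IsFirstOrder D) : IsTestFunction U (D f) where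
  contDiff := hD.contDiff hf.contDiff
  compact := hf.compact.mono' hD.support_subset
  support := (closure_minimal hD.support_subset (isClosed_tsupport f)).trans hf.support

theorem eq_zero_of_notMem (hf : IsTestFunction U f) {z : CSpace n} (hz : z ∉ U) : f z = 0 :=
  image_eq_zero_of_notMem_tsupport fun h => hz (hf.support h)

theorem tsupport_mul (F : CSpace n → ℂ) : tsupport (fun z => F z * f z) ⊆ tsupport f :=
  closure_mono fun _ hz hf => hz (by simp [hf])

/-- `F` need be smooth only on `U`: near any point outside the support of `f` the product vanishes
identically. -/
theorem mul (hf : IsTestFunction U f) (hU : IsOpen U) (hF : ContDiffOn ℝ ∞ F U) :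
    IsTestFunction U fun z => F z * f z where
  contDiff := by
    refine contDiff_iff_contDiffAt.2 fun z => ?_
    by_cases hz : z ∈ tsupport f
    · exact (hF.contDiffAt (hU.mem_nhds (hf.support hz))).mul hf.contDiff.contDiffAt
    · refine contDiffAt_const (c := (0 : ℂ)) |>.congr_of_eventuallyEq ?_
      filter_upwards [(isClosed_tsupport f).isOpen_compl.mem_nhds hz] with y hy
      rw [image_eq_zero_of_notMem_tsupport hy, mul_zero]
  compact := hf.compact.mono' ((subset_tsupport _).trans (tsupport_mul F))
  support := (tsupport_mul F).trans hf.support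

theorem integrable (hf : IsTestFunction U f) : Integrable f :=
  hf.contDiff.continuous.integrable_of_hasCompactSupport hf.compact

theorem setIntegral_eq (hf : IsTestFunction U f) : ∫ z in U, f z = ∫ z, f z :=
  setIntegral_eq_integral_of_forall_compl_eq_zero fun _ hz => hf.eq_zero_of_notMem hz

theorem setIntegral_mul_deriv (hf : IsTestFunction U f) (hU : IsOpen U)
    (hF : ContDiffOn ℝ ∞ F U) (hD : IsFirstOrder D) :
    ∫ z in U, F z * D f z = -∫ z in U, D F z * f z := by
  have hm := hf.mul hU hF
  have h0 : ∫ z in U, D (fun y => F y * f y) z = 0 := by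
    rw [(hm.deriv hD).setIntegral_eq, hD.integral_eq_zero hm.contDiff hm.compact]
  have h1 : ∫ z in U, D (fun y => F y * f y) z = ∫ z in U, (D F z * f z + F z * D f z) :=
    setIntegral_congr_fun hU.measurableSet fun z hz =>
      hD.mul ((hF.contDiffAt (hU.mem_nhds hz)).differentiableAt (by simp))
        (hf.contDiff.differentiable (by simp) z)
  rw [h1, integral_add (hf.mul hU (hD.contDiffOn hU hF)).integrable.integrableOn
    ((hf.deriv hD).mul hU hF).integrable.integrableOn] at h0
  exact eq_neg_of_add_eq_zero_right h0

end IsTestFunction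

/-- The divergence theorem in the form used for all three adjoints: `F` is the raised form times
`det g`, `f` holds the conjugate components of the test form, and `κ` indexes these components. -/
theorem setIntegral_sum_mul_deriv {U : Set (CSpace n)} (hU : IsOpen U) {ι κ : Type*} [Fintype ι]
    [Fintype κ] {D : ι → (CSpace n → ℂ) → CSpace n → ℂ} (hD : ∀ a, IsFirstOrder (D a))
    {F : ι → κ → CSpace n → ℂ} (hF : ∀ a b, ContDiffOn ℝ ∞ (F a b) U) {H f : κ → CSpace n → ℂ}
    (hf : ∀ b, IsTestFunction U (f b)) (h : ∀ z ∈ U, ∀ b, ∑ a, D a (F a b) z = -H b z) :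
    ∫ z in U, ∑ b, ∑ a, F a b z * D a (f b) z = ∫ z in U, ∑ b, H b z * f b z := by
  have h1 : ∫ z in U, ∑ b, ∑ a, F a b z * D a (f b) z
      = ∑ b, ∑ a, ∫ z in U, F a b z * D a (f b) z := by
    rw [integral_finsetSum _ fun b _ => integrable_finsetSum _ fun a _ =>
      (((hf b).deriv (hD a)).mul hU (hF a b)).integrable.integrableOn]
    refine Finset.sum_congr rfl fun b _ => integral_finsetSum _ fun a _ =>
      (((hf b).deriv (hD a)).mul hU (hF a b)).integrable.integrableOn
  have h2 : ∫ z in U, ∑ b, H b z * f b z = ∫ z in U, ∑ b, ∑ a, -(D a (F a b) z * f b z) := by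
    refine setIntegral_congr_fun hU.measurableSet fun z hz => Finset.sum_congr rfl fun b _ => ?_
    rw [Finset.sum_neg_distrib, ← Finset.sum_mul, h z hz b, neg_mul, neg_neg]
  have hi : ∀ b a, IntegrableOn (fun z => -(D a (F a b) z * f b z)) U := fun b a =>
    ((hf b).mul hU ((hD a).contDiffOn hU (hF a b))).integrable.neg.integrableOn
  rw [h1, h2, integral_finsetSum _ fun b _ => integrable_finsetSum _ fun a _ => hi b a]
  refine Finset.sum_congr rfl fun b _ => ?_
  rw [integral_finsetSum _ fun a _ => hi b a]
  refine Finset.sum_congr rfl fun a _ => ?_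
  rw [(hf b).setIntegral_mul_deriv hU (hF a b) (hD a), integral_neg]

theorem IsTestForm.isTestFunction {p q : ℕ} {U : Set (CSpace n)} {γ : CForm n p q}
    (hγ : IsTestForm U γ) (I : Fin p → Fin n) (J : Fin q → Fin n) :
    IsTestFunction U fun z => γ z I J :=
  ⟨contDiffOn_univ.1 (hγ.form.smooth I J), hγ.compact I J, hγ.support I J⟩

/-- At most one index of each type leaves only the identity permutation, so alternation is
automatic. -/
theorem isSmoothForm_of_le_one {p q : ℕ} (hp : p ≤ 1) (hq : q ≤ 1) {U : Set (CSpace n)}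
    {α : CForm n p q} (h : ∀ I J, ContDiffOn ℝ ∞ (fun z => α z I J) U) : IsSmoothForm U α := by
  have key : ∀ r ≤ 1, ∀ σ : Equiv.Perm (Fin r), σ = 1 := by
    intro r hr σ
    have : Subsingleton (Fin r) := Fin.subsingleton_iff_le_one.2 hr
    exact Subsingleton.elim _ _
  refine ⟨h, fun z _ I J σ => ?_, fun z _ I J σ => ?_⟩
  · rw [key p hp σ]; simp
  · rw [key q hq σ]; simp

/-! ### Uniqueness of adjoints -/

namespace IsMetricOn

variable {U : Set (CSpace n)} {G : CSpace n → Matrix (Fin n) (Fin n) ℂ}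

/-- The sum over multi-indices factors into a product of single-index sums, each a Kronecker delta.
-/
theorem sum_prod_gInv_mul (hG : IsMetricOn U G) {z : CSpace n} (hz : z ∈ U) {p : ℕ}
    (I I₀ : Fin p → Fin n) :
    ∑ A : Fin p → Fin n, (∏ s, gInv G z (I s) (A s)) * ∏ s, G z (I₀ s) (A s)
      = if I₀ = I then 1 else 0 := by
  simp only [← Finset.prod_mul_distrib]
  rw [← Fintype.piFinset_univ, ← Finset.prod_univ_sum (fun _ => Finset.univ)
    (fun s l => gInv G z (I s) l * G z (I₀ s) l)]
  simp only [hG.sum_gInv_mul hz, funext_iff, Finset.prod_ite_zero]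
  simp

theorem sum_prod_gInv_mul' (hG : IsMetricOn U G) {z : CSpace n} (hz : z ∈ U) {p : ℕ}
    (I I₀ : Fin p → Fin n) :
    ∑ A : Fin p → Fin n, (∏ s, gInv G z (A s) (I s)) * ∏ s, G z (A s) (I₀ s)
      = if I₀ = I then 1 else 0 := by
  simp only [← Finset.prod_mul_distrib]
  rw [← Fintype.piFinset_univ, ← Finset.prod_univ_sum (fun _ => Finset.univ)
    (fun s l => gInv G z l (I s) * G z l (I₀ s))]
  simp only [hG.sum_gInv_mul' hz, funext_iff, Finset.prod_ite_zero]
  simp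

/-- The form dual to the component `(I₀, J₀)`. -/
theorem formInner_dual (hG : IsMetricOn U G) {z : CSpace n} (hz : z ∈ U) {p q : ℕ}
    (α : CForm n p q) (χ : CSpace n → ℝ) (I₀ : Fin p → Fin n) (J₀ : Fin q → Fin n) :
    formInner G α (fun y A B => ((∏ s, G y (A s) (I₀ s)) * ∏ s, G y (J₀ s) (B s)) * (χ y : ℂ)) z
      = (1 / ((p.factorial : ℂ) * (q.factorial : ℂ))) * (χ z * α z I₀ J₀) := by
  rw [formInner]
  congr 1
  simp only [map_mul, map_prod, hG.conj_apply hz, Complex.conj_ofReal]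
  calc _ = ∑ I : Fin p → Fin n, ∑ J : Fin q → Fin n,
        (∑ A : Fin p → Fin n, (∏ s, gInv G z (I s) (A s)) * ∏ s, G z (I₀ s) (A s)) *
        ((∑ B : Fin q → Fin n, (∏ s, gInv G z (B s) (J s)) * ∏ s, G z (B s) (J₀ s)) *
          (χ z * α z I J)) := by
        refine Finset.sum_congr rfl fun I _ => ?_
        rw [Finset.sum_comm]
        refine Finset.sum_congr rfl fun J _ => ?_
        rw [Finset.sum_mul]
        refine Finset.sum_congr rfl fun A _ => ?_
        rw [Finset.sum_mul, Finset.mul_sum]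
        refine Finset.sum_congr rfl fun B _ => ?_
        ring
    _ = _ := by
        simp only [hG.sum_prod_gInv_mul hz, hG.sum_prod_gInv_mul' hz]
        simp

/-- Pairing with the dual form times a bump function `χ` isolates one component, so the difference
of two adjoints times `det g` integrates to zero against every `χ`; being continuous, it vanishes.
The degree bounds make these dual forms alternating without antisymmetrization. -/
theorem isL2Adjoint_unique (hG : IsMetricOn U G) {p q p' q' : ℕ} (hp : p ≤ 1) (hq : q ≤ 1)
    {D : CForm n p q → CForm n p' q'} {β : CForm n p' q'} {η η' : CForm n p q}
    (h : IsL2Adjoint U G D β η) (h' : IsL2Adjoint U G D β η') : Set.EqOn η η' U := by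
  have hU := hG.isOpen
  have key : ∀ I₀ J₀, Set.EqOn (fun z => (η z I₀ J₀ - η' z I₀ J₀) * (G z).det) (fun _ => 0) U := by
    intro I₀ J₀
    have hs : ContDiffOn ℝ ∞ (fun z => (η z I₀ J₀ - η' z I₀ J₀) * (G z).det) U :=
      ((h.smooth.smooth I₀ J₀).sub (h'.smooth.smooth I₀ J₀)).mul hG.contDiffOn_det
    have hae := hU.ae_eq_zero_of_integral_contDiff_smul_eq_zero (μ := volume)
      (hs.continuousOn.locallyIntegrableOn hU.measurableSet) (fun χ hχ hc hsupp => ?_)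
    · refine Measure.eqOn_open_of_ae_eq (μ := volume) ?_ hU hs.continuousOn continuousOn_const
      exact (ae_restrict_iff' hU.measurableSet).2 hae
    · have hχ' : IsTestFunction U fun z => (χ z : ℂ) :=
        ⟨Complex.ofRealCLM.contDiff.comp hχ, hc.comp_left (g := fun r : ℝ => (r : ℂ)) (by simp),
          (tsupport_comp_subset (g := fun r : ℝ => (r : ℂ)) (by simp) χ).trans hsupp⟩
      set γ : CForm n p q := fun y A B =>
        ((∏ s, G y (A s) (I₀ s)) * ∏ s, G y (J₀ s) (B s)) * (χ y : ℂ) with hγdef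
      have hγ' : ∀ A B, IsTestFunction U fun z => γ z A B := fun A B =>
        hχ'.mul hU ((contDiffOn_prod fun s _ => hG.smooth _ _).mul
          (contDiffOn_prod fun s _ => hG.smooth _ _))
      have hγ : IsTestForm U γ :=
        ⟨isSmoothForm_of_le_one hp hq fun A B => (hγ' A B).contDiff.contDiffOn,
          fun A B => (hγ' A B).compact, fun A B => (hγ' A B).support⟩
      have hl : ∀ α : CForm n p q, l2Inner U G α γ
          = (1 / ((p.factorial : ℂ) * (q.factorial : ℂ))) *
            ∫ z in U, (α z I₀ J₀ * (G z).det) * χ z := by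
        intro α
        rw [l2Inner, ← integral_const_mul]
        refine setIntegral_congr_fun hU.measurableSet fun z hz => ?_
        simp only [hγdef, hG.formInner_dual hz]
        ring
      have he := (h.adjoint γ hγ).trans (h'.adjoint γ hγ).symm
      rw [hl, hl] at he
      have he' := mul_left_cancel₀ (by simp [Nat.factorial_ne_zero]) he
      have hi : ∀ α : CForm n p q, IsSmoothForm U α →
          IntegrableOn (fun z => (α z I₀ J₀ * (G z).det) * (χ z : ℂ)) U := fun α hα =>
        (hχ'.mul hU ((hα.smooth I₀ J₀).mul hG.contDiffOn_det)).integrable.integrableOn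
      rw [← sub_eq_zero, ← integral_sub (hi η h.smooth) (hi η' h'.smooth)] at he'
      rw [← (hχ'.mul hU hs).setIntegral_eq.trans (integral_congr_ae (.of_forall fun z => ?_)), ← he']
      · refine integral_congr_ae (.of_forall fun z => ?_)
        simp only
        ring
      · simp only [Complex.real_smul]
        ring
  intro z hz
  ext I₀ J₀
  have := key I₀ J₀ hz
  simp only [mul_eq_zero, hG.det_ne_zero hz, or_false] at this
  exact sub_eq_zero.1 this

end IsMetricOn

/-- Uniqueness lets the form picked by choice be replaced on `U` by an explicit one. -/
theorem eqOn_l2Adjoint {p q p' q' : ℕ} {U : Set (CSpace n)}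
    {G : CSpace n → Matrix (Fin n) (Fin n) ℂ} (hG : IsMetricOn U G) (hp : p ≤ 1) (hq : q ≤ 1)
    {D : CForm n p q → CForm n p' q'} {β : CForm n p' q'} {η : CForm n p q}
    (h : IsL2Adjoint U G D β η) : Set.EqOn (l2Adjoint U G D β) η U := by
  have hex : ∃ η, IsL2Adjoint U G D β η := ⟨η, h⟩
  rw [l2Adjoint, dif_pos hex]
  exact hG.isL2Adjoint_unique hp hq hex.choose_spec h

theorem hasUniqueL2Adjoint {p q p' q' : ℕ} {U : Set (CSpace n)}
    {G : CSpace n → Matrix (Fin n) (Fin n) ℂ} (hG : IsMetricOn U G) (hp : p ≤ 1) (hq : q ≤ 1)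
    {D : CForm n p q → CForm n p' q'} {β : CForm n p' q'} {η : CForm n p q}
    (h : IsL2Adjoint U G D β η) : HasUniqueL2Adjoint U G D β :=
  ⟨⟨η, h⟩, fun _ _ => hG.isL2Adjoint_unique hp hq⟩

/-! ### Components of forms of low degree -/

theorem sum_fin_one {α : Type*} [AddCommMonoid α] (f : (Fin 1 → Fin n) → α) :
    ∑ I, f I = ∑ i, f ![i] :=
  Fintype.sum_equiv (Equiv.funUnique (Fin 1) (Fin n)) _ _ fun I => by
    congr 1
    ext s
    rw [Subsingleton.elim s 0]
    rfl

theorem sum_fin_two {α : Type*} [AddCommMonoid α] (f : (Fin 2 → Fin n) → α) :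
    ∑ I, f I = ∑ i, ∑ j, f ![i, j] := by
  rw [← Fintype.sum_prod_type' (f := fun i j => f ![i, j])]
  refine Fintype.sum_equiv (finTwoArrowEquiv (Fin n)) _ _ fun I => ?_
  congr 1
  ext s
  fin_cases s <;> rfl

theorem sum_fin_zero {α : Type*} [AddCommMonoid α] (f : (Fin 0 → Fin n) → α) :
    ∑ I, f I = f ![] := by
  rw [Fintype.sum_unique]
  exact congrArg f (Subsingleton.elim _ _)

theorem eq_vec_one (I : Fin 1 → Fin n) : I = ![I 0] := by
  ext s
  rw [Subsingleton.elim s 0]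
  rfl

theorem succAbove_vec_one (a : Fin n) (k : Fin 1) :
    (fun s : Fin 0 => (![a] : Fin 1 → Fin n) (k.succAbove s)) = ![] :=
  Subsingleton.elim _ _

theorem succAbove_vec_two_zero (a b : Fin n) :
    (fun s : Fin 1 => (![a, b] : Fin 2 → Fin n) ((0 : Fin 2).succAbove s)) = ![b] :=
  eq_vec_one _

theorem succAbove_vec_two_one (a b : Fin n) :
    (fun s : Fin 1 => (![a, b] : Fin 2 → Fin n) ((1 : Fin 2).succAbove s)) = ![a] :=
  eq_vec_one _

theorem del_zero {q : ℕ} (γ : CForm n 0 q) (z : CSpace n) (a : Fin n) (J : Fin q → Fin n) :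
    del γ z ![a] J = dz a (fun y => γ y ![] J) z := by
  change ∑ k : Fin 1, (-1 : ℂ) ^ (k : ℕ) * dz ((![a] : Fin 1 → Fin n) k)
    (fun y => γ y (fun s : Fin 0 => (![a] : Fin 1 → Fin n) (k.succAbove s)) J) z = _
  rw [Fin.sum_univ_one, succAbove_vec_one]
  simp

theorem del_one {q : ℕ} (γ : CForm n 1 q) (z : CSpace n) (a b : Fin n) (J : Fin q → Fin n) :
    del γ z ![a, b] J = dz a (fun y => γ y ![b] J) z - dz b (fun y => γ y ![a] J) z := by
  change ∑ k : Fin 2, (-1 : ℂ) ^ (k : ℕ) * dz ((![a, b] : Fin 2 → Fin n) k)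
    (fun y => γ y (fun s : Fin 1 => (![a, b] : Fin 2 → Fin n) (k.succAbove s)) J) z = _
  rw [Fin.sum_univ_two, succAbove_vec_two_zero, succAbove_vec_two_one]
  simp [sub_eq_add_neg]

theorem delbar_zero {p : ℕ} (γ : CForm n p 0) (z : CSpace n) (b : Fin n) (I : Fin p → Fin n) :
    delbar γ z I ![b] = (-1) ^ p * dzbar b (fun y => γ y I ![]) z := by
  change (-1) ^ p * ∑ k : Fin 1, (-1 : ℂ) ^ (k : ℕ) * dzbar ((![b] : Fin 1 → Fin n) k)
    (fun y => γ y I (fun s : Fin 0 => (![b] : Fin 1 → Fin n) (k.succAbove s))) z = _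
  rw [Fin.sum_univ_one, succAbove_vec_one]
  simp

theorem delbar_one {p : ℕ} (γ : CForm n p 1) (z : CSpace n) (a b : Fin n) (I : Fin p → Fin n) :
    delbar γ z I ![a, b]
      = (-1) ^ p * (dzbar a (fun y => γ y I ![b]) z - dzbar b (fun y => γ y I ![a]) z) := by
  change (-1) ^ p * ∑ k : Fin 2, (-1 : ℂ) ^ (k : ℕ) * dzbar ((![a, b] : Fin 2 → Fin n) k)
    (fun y => γ y I (fun s : Fin 1 => (![a, b] : Fin 2 → Fin n) (k.succAbove s))) z = _
  rw [Fin.sum_univ_two, succAbove_vec_two_zero, succAbove_vec_two_one]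
  simp [sub_eq_add_neg]

/-- This links the real definition to `(√-1/2) A_{j k̄}`. The computation is entrywise and does not
need `A` to be Hermitian. -/
theorem assocForm_apply (A : CSpace n → Matrix (Fin n) (Fin n) ℂ) (z : CSpace n)
    (I J : Fin 1 → Fin n) : assocForm A z I J = Complex.I / 2 * A z (I 0) (J 0) := by
  have h : ∀ (j k : Fin n) (c d : ℂ),
      realTensor (A z) (Pi.single j c) (Complex.I • Pi.single k d)
        = (A z j k * c * conj (Complex.I * d)).re := by
    intro j k c d
    rw [realTensor, Finset.sum_eq_single j, Finset.sum_eq_single k]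
    · simp
    · intro l _ hl; simp [hl]
    · simp
    · intro l _ hl; simp [hl]
    · simp
  simp only [assocForm, complexEntry, h]
  apply Complex.ext <;> simp <;> ring

theorem kahlerForm_apply (G : CSpace n → Matrix (Fin n) (Fin n) ℂ) (z : CSpace n)
    (I J : Fin 1 → Fin n) : kahlerForm G z I J = Complex.I / 2 * G z (I 0) (J 0) :=
  assocForm_apply G z I J

theorem formInner_eq {p q : ℕ} (G : CSpace n → Matrix (Fin n) (Fin n) ℂ) (α β : CForm n p q)
    (z : CSpace n) :
    formInner G α β z = (1 / ((p.factorial : ℂ) * (q.factorial : ℂ))) * ∑ A, ∑ B,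
      (∑ I, ∑ J, (∏ s, gInv G z (I s) (A s)) * (∏ s, gInv G z (B s) (J s)) * α z I J) *
        conj (β z A B) := by
  rw [formInner, Finset.sum_comm]
  congr 1
  refine Finset.sum_congr rfl fun A _ => ?_
  simp only [Finset.sum_mul, mul_assoc]
  rw [Finset.sum_comm' (t' := Finset.univ) (s' := fun _ => Finset.univ) (by simp),
    Finset.sum_congr rfl fun J _ => Finset.sum_comm, Finset.sum_comm]
  exact Finset.sum_congr rfl fun B _ => Finset.sum_comm

theorem formInner_zero_one (G : CSpace n → Matrix (Fin n) (Fin n) ℂ) (α β : CForm n 0 1)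
    (z : CSpace n) :
    formInner G α β z = ∑ b, (∑ j, gInv G z b j * α z ![] ![j]) * conj (β z ![] ![b]) := by
  simp only [formInner_eq, sum_fin_zero, sum_fin_one]
  simp

theorem formInner_one_zero (G : CSpace n → Matrix (Fin n) (Fin n) ℂ) (α β : CForm n 1 0)
    (z : CSpace n) :
    formInner G α β z = ∑ a, (∑ i, gInv G z i a * α z ![i] ![]) * conj (β z ![a] ![]) := by
  simp only [formInner_eq, sum_fin_zero, sum_fin_one]
  simp

theorem formInner_one_one (G : CSpace n → Matrix (Fin n) (Fin n) ℂ) (α β : CForm n 1 1)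
    (z : CSpace n) :
    formInner G α β z = ∑ a, ∑ b, (∑ i, ∑ j, gInv G z i a * gInv G z b j * α z ![i] ![j]) *
      conj (β z ![a] ![b]) := by
  simp [formInner_eq, sum_fin_one]

theorem formInner_two_one (G : CSpace n → Matrix (Fin n) (Fin n) ℂ) (α β : CForm n 2 1)
    (z : CSpace n) :
    formInner G α β z = 1 / 2 * ∑ a, ∑ b, ∑ d,
      (∑ i, ∑ j, ∑ k, gInv G z i a * gInv G z j b * gInv G z d k * α z ![i, j] ![k]) *
        conj (β z ![a, b] ![d]) := by
  simp [formInner_eq, sum_fin_one, sum_fin_two]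

/-! ### Adjoints in components -/

section Adjoint

variable {U : Set (CSpace n)} {G : CSpace n → Matrix (Fin n) (Fin n) ℂ}

/-- A pointwise criterion: `h` is the adjoint equation after the derivative has been moved off the
test form, with one index of the unknown `η` still raised. -/
theorem isL2Adjoint_del_zero_one (hG : IsMetricOn U G) {β : CForm n 1 1} {η : CForm n 0 1}
    (hβ : ∀ i j, ContDiffOn ℝ ∞ (fun z => β z ![i] ![j]) U)
    (hη : ∀ j, ContDiffOn ℝ ∞ (fun z => η z ![] ![j]) U)
    (h : ∀ z ∈ U, ∀ b,
      ∑ a, dzbar a (fun y => (∑ i, ∑ j, gInv G y i a * gInv G y b j * β y ![i] ![j]) *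
        (G y).det) z = -((∑ j, gInv G z b j * η z ![] ![j]) * (G z).det)) :
    IsL2Adjoint U G del β η := by
  refine ⟨isSmoothForm_of_le_one zero_le_one le_rfl fun I J => ?_, fun γ hγ => ?_⟩
  · rw [Subsingleton.elim I ![], eq_vec_one J]
    exact hη _
  have hγ' := fun b => (hγ.isTestFunction ![] ![b]).comp_conj
  have key := setIntegral_sum_mul_deriv hG.isOpen (fun a : Fin n => isFirstOrder_dzbar a)
    (F := fun a b y => (∑ i, ∑ j, gInv G y i a * gInv G y b j * β y ![i] ![j]) * (G y).det)
    (fun a b => (ContDiffOn.sum fun i _ => ContDiffOn.sum fun j _ =>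
      ((hG.contDiffOn_gInv i a).mul (hG.contDiffOn_gInv b j)).mul (hβ i j)).mul hG.contDiffOn_det)
    (H := fun b z => (∑ j, gInv G z b j * η z ![] ![j]) * (G z).det) hγ' h
  rw [l2Inner, l2Inner]
  refine (Eq.trans ?_ key.symm).trans ?_
  · congr 1 with z
    rw [formInner_zero_one, Finset.sum_mul]
    exact Finset.sum_congr rfl fun b _ => by ring
  · congr 1 with z
    rw [formInner_one_one, Finset.sum_mul, Finset.sum_comm]
    refine Finset.sum_congr rfl fun a _ => ?_
    rw [Finset.sum_mul]
    refine Finset.sum_congr rfl fun b _ => ?_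
    rw [del_zero, conj_dz a ((hγ.isTestFunction ![] ![b]).contDiff.differentiable (by simp) z)]
    ring

theorem isL2Adjoint_delbar_one_zero (hG : IsMetricOn U G) {β : CForm n 1 1} {η : CForm n 1 0}
    (hβ : ∀ i j, ContDiffOn ℝ ∞ (fun z => β z ![i] ![j]) U)
    (hη : ∀ i, ContDiffOn ℝ ∞ (fun z => η z ![i] ![]) U)
    (h : ∀ z ∈ U, ∀ a,
      ∑ b, dz b (fun y => (∑ i, ∑ j, gInv G y i a * gInv G y b j * β y ![i] ![j]) *
        (G y).det) z = (∑ i, gInv G z i a * η z ![i] ![]) * (G z).det) :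
    IsL2Adjoint U G delbar β η := by
  refine ⟨isSmoothForm_of_le_one le_rfl zero_le_one fun I J => ?_, fun γ hγ => ?_⟩
  · rw [Subsingleton.elim J ![], eq_vec_one I]
    exact hη _
  have hγ' := fun a => (hγ.isTestFunction ![a] ![]).comp_conj
  have key := setIntegral_sum_mul_deriv hG.isOpen (fun b : Fin n => isFirstOrder_dz b)
    (F := fun b a y => (∑ i, ∑ j, gInv G y i a * gInv G y b j * β y ![i] ![j]) * (G y).det)
    (fun b a => (ContDiffOn.sum fun i _ => ContDiffOn.sum fun j _ =>
      ((hG.contDiffOn_gInv i a).mul (hG.contDiffOn_gInv b j)).mul (hβ i j)).mul hG.contDiffOn_det)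
    (H := fun a z => -((∑ i, gInv G z i a * η z ![i] ![]) * (G z).det)) hγ'
    (fun z hz a => by rw [h z hz a, neg_neg])
  -- Moving `dz̄` past `dz` gives `∂̄` a sign on `(1,0)`-forms, which offsets the sign from
  -- integration by parts; negating both sides matches the general formula.
  rw [l2Inner, l2Inner, ← neg_inj]
  refine (Eq.trans ?_ key.symm).trans ?_
  · rw [← integral_neg]
    congr 1 with z
    rw [formInner_one_zero, Finset.sum_mul, ← Finset.sum_neg_distrib]
    exact Finset.sum_congr rfl fun b _ => by ring
  · rw [← integral_neg]
    congr 1 with z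
    rw [formInner_one_one, Finset.sum_mul, ← Finset.sum_neg_distrib]
    refine Finset.sum_congr rfl fun a _ => ?_
    rw [Finset.sum_mul, ← Finset.sum_neg_distrib]
    refine Finset.sum_congr rfl fun b _ => ?_
    rw [delbar_zero, map_mul,
      conj_dzbar b ((hγ.isTestFunction ![a] ![]).contDiff.differentiable (by simp) z)]
    simp
    ring

/-- `⟨β, ∂γ⟩` in terms of the derivatives of the conjugate components of `γ`. -/
theorem formInner_del_one_one (β : CForm n 2 1) (γ : CForm n 1 1) (z : CSpace n)
    (hβ : ∀ i j k, β z ![j, i] ![k] = -β z ![i, j] ![k])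
    (hγ : ∀ i j, DifferentiableAt ℝ (fun y => γ y ![i] ![j]) z) :
    formInner G β (del γ) z = ∑ b, ∑ d, ∑ a,
      (∑ i, ∑ j, ∑ k, gInv G z i a * gInv G z j b * gInv G z d k * β z ![i, j] ![k]) *
        dzbar a (fun y => conj (γ y ![b] ![d])) z := by
  rw [formInner_two_one]
  -- `R` is `β` with all indices raised; it inherits antisymmetry in its first two.
  generalize hR : (fun a b d => ∑ i, ∑ j, ∑ k,
    gInv G z i a * gInv G z j b * gInv G z d k * β z ![i, j] ![k]) = R
  have hR1 : ∀ a b d, ∑ i, ∑ j, ∑ k,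
    gInv G z i a * gInv G z j b * gInv G z d k * β z ![i, j] ![k] = R a b d := by
    intro a b d; rw [← hR]
  have hR' : ∀ a b d, R b a d = -R a b d := by
    intro a b d
    rw [← hR1, ← hR1, Finset.sum_comm]
    simp only [← Finset.sum_neg_distrib]
    refine Finset.sum_congr rfl fun i _ => Finset.sum_congr rfl fun j _ =>
      Finset.sum_congr rfl fun k _ => ?_
    rw [hβ i j k]
    ring
  simp only [hR1]
  have hd : ∀ a b d, conj (del γ z ![a, b] ![d])
      = dzbar a (fun y => conj (γ y ![b] ![d])) z - dzbar b (fun y => conj (γ y ![a] ![d])) z := by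
    intro a b d
    rw [del_one, map_sub, conj_dz a (hγ b d), conj_dz b (hγ a d)]
  have hs : ∑ a, ∑ b, ∑ d, R a b d * dzbar b (fun y => conj (γ y ![a] ![d])) z
      = -∑ a, ∑ b, ∑ d, R a b d * dzbar a (fun y => conj (γ y ![b] ![d])) z := by
    rw [Finset.sum_comm]
    simp only [← Finset.sum_neg_distrib]
    refine Finset.sum_congr rfl fun a _ => Finset.sum_congr rfl fun b _ =>
      Finset.sum_congr rfl fun d _ => ?_
    rw [hR' a b d]
    ring
  simp only [hd, mul_sub, Finset.sum_sub_distrib, hs]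
  -- By antisymmetry both terms of `∂γ` contribute equally, which absorbs the factor `1/2!` in the
  -- inner product.
  have half : ∀ x : ℂ, 1 / 2 * x - 1 / 2 * -x = x := fun x => by ring
  rw [half, Finset.sum_comm]
  exact Finset.sum_congr rfl fun b _ => Finset.sum_comm

theorem isL2Adjoint_del_one_one (hG : IsMetricOn U G) {β : CForm n 2 1} {η : CForm n 1 1}
    (hβ : ∀ i j k, ContDiffOn ℝ ∞ (fun z => β z ![i, j] ![k]) U)
    (hβ' : ∀ z i j k, β z ![j, i] ![k] = -β z ![i, j] ![k])
    (hη : ∀ i j, ContDiffOn ℝ ∞ (fun z => η z ![i] ![j]) U)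
    (h : ∀ z ∈ U, ∀ b d,
      ∑ a, dzbar a (fun y => (∑ i, ∑ j, ∑ k, gInv G y i a * gInv G y j b * gInv G y d k *
        β y ![i, j] ![k]) * (G y).det) z
        = -((∑ j, ∑ k, gInv G z j b * gInv G z d k * η z ![j] ![k]) * (G z).det)) :
    IsL2Adjoint U G del β η := by
  refine ⟨isSmoothForm_of_le_one le_rfl le_rfl fun I J => ?_, fun γ hγ => ?_⟩
  · rw [eq_vec_one I, eq_vec_one J]
    exact hη _ _
  have hγ' := fun x : Fin n × Fin n => (hγ.isTestFunction ![x.1] ![x.2]).comp_conj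
  have hF : ∀ (a : Fin n) (x : Fin n × Fin n), ContDiffOn ℝ ∞ (fun y =>
      (∑ i, ∑ j, ∑ k, gInv G y i a * gInv G y j x.1 * gInv G y x.2 k *
        β y ![i, j] ![k]) * (G y).det) U := fun a x =>
    (ContDiffOn.sum fun i _ => ContDiffOn.sum fun j _ => ContDiffOn.sum fun k _ =>
      (((hG.contDiffOn_gInv i a).mul (hG.contDiffOn_gInv j x.1)).mul
        (hG.contDiffOn_gInv x.2 k)).mul (hβ i j k)).mul hG.contDiffOn_det
  have key := setIntegral_sum_mul_deriv hG.isOpen (fun a : Fin n => isFirstOrder_dzbar a) hF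
    (H := fun x z => (∑ j, ∑ k, gInv G z j x.1 * gInv G z x.2 k * η z ![j] ![k]) * (G z).det) hγ'
    (fun z hz x => h z hz x.1 x.2)
  rw [l2Inner, l2Inner]
  refine (Eq.trans ?_ key.symm).trans ?_
  · congr 1 with z
    rw [formInner_one_one, Fintype.sum_prod_type, Finset.sum_mul]
    refine Finset.sum_congr rfl fun a _ => ?_
    rw [Finset.sum_mul]
    exact Finset.sum_congr rfl fun b _ => by ring
  · congr 1 with z
    rw [formInner_del_one_one β γ z (hβ' z) fun i j =>
      (hγ.isTestFunction ![i] ![j]).contDiff.differentiable (by simp) z]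
    rw [Fintype.sum_prod_type, Finset.sum_mul]
    refine Finset.sum_congr rfl fun b _ => ?_
    rw [Finset.sum_mul]
    refine Finset.sum_congr rfl fun d _ => ?_
    rw [Finset.sum_mul]
    exact Finset.sum_congr rfl fun a _ => mul_right_comm _ _ _

end Adjoint

/-! ### The adjoints of the Kähler form -/

/-- The matrix `(T_{a j k̄})_{j k}`. -/
def torsionMatrix (G : CSpace n → Matrix (Fin n) (Fin n) ℂ) (a : Fin n) (z : CSpace n) :
    Matrix (Fin n) (Fin n) ℂ := fun j k => torsion G z a j k

/-- The covariant derivative `-∇_{m̄} T_{a j k̄}` for the metric in the indices `j`, `k̄`. -/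
def torsionDeriv (G : CSpace n → Matrix (Fin n) (Fin n) ℂ) (a m : Fin n) (z : CSpace n) :
    Matrix (Fin n) (Fin n) ℂ :=
  -matD (dzbar m) (torsionMatrix G a) z + matD (dzbar m) G z * (G z)⁻¹ * torsionMatrix G a z
    + torsionMatrix G a z * (G z)⁻¹ * matD (dzbar m) G z

/-- The `(0,1)`-form `∂*ω`. -/
def delStarKahler (G : CSpace n → Matrix (Fin n) (Fin n) ℂ) : CForm n 0 1 := fun z _ J =>
  -(Complex.I / 2) * trTorsionBar G z (J 0)

/-- The `(1,0)`-form `∂̄*ω`. -/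
def delbarStarKahler (G : CSpace n → Matrix (Fin n) (Fin n) ℂ) : CForm n 1 0 := fun z I _ =>
  Complex.I / 2 * trTorsion G z (I 0)

/-- The `(1,1)`-form `∂*∂ω`. -/
def delStarDelKahler (G : CSpace n → Matrix (Fin n) (Fin n) ℂ) : CForm n 1 1 := fun z I J =>
  Complex.I / 2 * ∑ a, ∑ m, gInv G z a m *
    (torsionDeriv G a m z (I 0) (J 0) - trTorsionBar G z m * torsion G z a (I 0) (J 0))

/-- Raising both indices is multiplication by `G⁻¹` on each side, so the product rule can be applied
to matrices instead of index sums. -/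
theorem sum_gInv_gInv_mul (G : CSpace n → Matrix (Fin n) (Fin n) ℂ) (z : CSpace n)
    (X : Matrix (Fin n) (Fin n) ℂ) (b d : Fin n) :
    ∑ j, ∑ k, gInv G z j b * gInv G z d k * X j k = ((G z)⁻¹ * X * (G z)⁻¹) b d := by
  rw [Matrix.mul_apply]
  simp only [Matrix.mul_apply, Finset.sum_mul]
  rw [Finset.sum_comm]
  refine Finset.sum_congr rfl fun k _ => Finset.sum_congr rfl fun j _ => ?_
  simp only [gInv]
  ring

namespace IsMetricOn

variable {U : Set (CSpace n)} {G : CSpace n → Matrix (Fin n) (Fin n) ℂ} {z : CSpace n}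

theorem sum_gInv_gInv_mul_kahlerForm (hG : IsMetricOn U G) (hz : z ∈ U) (a b : Fin n) :
    ∑ i, ∑ j, gInv G z i a * gInv G z b j * kahlerForm G z ![i] ![j]
      = Complex.I / 2 * gInv G z b a := by
  simp only [kahlerForm_apply, Matrix.cons_val_zero]
  calc _ = ∑ i, Complex.I / 2 * gInv G z i a * ∑ j, gInv G z b j * G z i j := by
        refine Finset.sum_congr rfl fun i _ => ?_
        rw [Finset.mul_sum]
        exact Finset.sum_congr rfl fun j _ => by ring
    _ = _ := by simp [hG.sum_gInv_mul hz]

theorem contDiffOn_gInv_mul_det (hG : IsMetricOn U G) (b a : Fin n) :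
    ContDiffOn ℝ ∞ (fun y => gInv G y b a * (G y).det) U :=
  (hG.contDiffOn_gInv b a).mul hG.contDiffOn_det

theorem contDiffOn_kahlerForm (hG : IsMetricOn U G) (I J : Fin 1 → Fin n) :
    ContDiffOn ℝ ∞ (fun z => kahlerForm G z I J) U := by
  simp only [kahlerForm_apply]
  exact contDiffOn_const.mul (hG.smooth _ _)

theorem isL2Adjoint_delStarKahler (hG : IsMetricOn U G) :
    IsL2Adjoint U G del (kahlerForm G) (delStarKahler G) := by
  refine isL2Adjoint_del_zero_one hG (fun i j => hG.contDiffOn_kahlerForm _ _)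
    (fun j => contDiffOn_const.mul (hG.contDiffOn_trTorsionBar _)) fun z hz b => ?_
  have h : ∀ a, dzbar a (fun y => (∑ i, ∑ j, gInv G y i a * gInv G y b j *
      kahlerForm G y ![i] ![j]) * (G y).det) z
      = Complex.I / 2 * dzbar a (fun y => gInv G y b a * (G y).det) z := by
    intro a
    rw [← (isFirstOrder_dzbar a).const_mul _
      (hG.differentiableAt hz (hG.contDiffOn_gInv_mul_det b a))]
    refine (isFirstOrder_dzbar a).congr_on hG.isOpen (fun y hy => ?_) hz
    simp only [hG.sum_gInv_gInv_mul_kahlerForm hy]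
    rw [mul_assoc]
  simp only [h, ← Finset.mul_sum, hG.sum_dzbar_gInv_mul_det hz, delStarKahler,
    Matrix.cons_val_zero, mul_left_comm _ (-(Complex.I / 2))]
  ring

theorem isL2Adjoint_delbarStarKahler (hG : IsMetricOn U G) :
    IsL2Adjoint U G delbar (kahlerForm G) (delbarStarKahler G) := by
  refine isL2Adjoint_delbar_one_zero hG (fun i j => hG.contDiffOn_kahlerForm _ _)
    (fun j => contDiffOn_const.mul (hG.contDiffOn_trTorsion _)) fun z hz a => ?_
  have h : ∀ b, dz b (fun y => (∑ i, ∑ j, gInv G y i a * gInv G y b j *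
      kahlerForm G y ![i] ![j]) * (G y).det) z
      = Complex.I / 2 * dz b (fun y => gInv G y b a * (G y).det) z := by
    intro b
    rw [← (isFirstOrder_dz b).const_mul _
      (hG.differentiableAt hz (hG.contDiffOn_gInv_mul_det b a))]
    refine (isFirstOrder_dz b).congr_on hG.isOpen (fun y hy => ?_) hz
    simp only [hG.sum_gInv_gInv_mul_kahlerForm hy]
    rw [mul_assoc]
  simp only [h, ← Finset.mul_sum, hG.sum_dz_gInv_mul_det hz, delbarStarKahler,
    Matrix.cons_val_zero, mul_left_comm _ (Complex.I / 2)]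
  ring

theorem del_kahlerForm (hG : IsMetricOn U G) (hz : z ∈ U) (a b k : Fin n) :
    del (kahlerForm G) z ![a, b] ![k] = Complex.I / 2 * torsion G z a b k := by
  rw [del_one]
  simp only [kahlerForm_apply, Matrix.cons_val_zero]
  rw [(isFirstOrder_dz a).const_mul _ (hG.differentiableAt hz (hG.smooth _ _)),
    (isFirstOrder_dz b).const_mul _ (hG.differentiableAt hz (hG.smooth _ _)), hG.torsion_eq hz]
  ring

theorem delbar_kahlerForm (hG : IsMetricOn U G) (hz : z ∈ U) (a b k : Fin n) :
    delbar (kahlerForm G) z ![k] ![a, b] = -(Complex.I / 2) * torsionBar G z a b k := by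
  rw [delbar_one]
  simp only [kahlerForm_apply, Matrix.cons_val_zero]
  rw [(isFirstOrder_dzbar a).const_mul _ (hG.differentiableAt hz (hG.smooth _ _)),
    (isFirstOrder_dzbar b).const_mul _ (hG.differentiableAt hz (hG.smooth _ _)),
    hG.torsionBar_eq hz]
  ring

/-- The two correction terms in `torsionDeriv` are the derivatives of the outer factors `G⁻¹`,
pulled inside. -/
theorem matD_sandwich (hG : IsMetricOn U G) (hz : z ∈ U) (a m : Fin n) :
    matD (dzbar m) (fun y => (G y)⁻¹ * torsionMatrix G a y * (G y)⁻¹) z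
      = -((G z)⁻¹ * torsionDeriv G a m z * (G z)⁻¹) := by
  have hP : ∀ j k, DifferentiableAt ℝ (fun y => (G y)⁻¹ j k) z := fun j k =>
    hG.differentiableAt hz (hG.contDiffOn_gInv k j)
  have hT : ∀ j k, DifferentiableAt ℝ (fun y => torsionMatrix G a y j k) z := fun j k =>
    hG.differentiableAt hz (hG.contDiffOn_torsion a j k)
  rw [matD_mul (F := fun y => (G y)⁻¹ * torsionMatrix G a y) (H := fun y => (G y)⁻¹)
      (isFirstOrder_dzbar m) (differentiableAt_matrix_mul hP hT) hP,
    matD_mul (F := fun y => (G y)⁻¹) (isFirstOrder_dzbar m) hP hT,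
    hG.matD_inv (isFirstOrder_dzbar m) hz, torsionDeriv]
  noncomm_ring

theorem contDiffOn_sandwich (hG : IsMetricOn U G) (a b d : Fin n) :
    ContDiffOn ℝ ∞ (fun y => ((G y)⁻¹ * torsionMatrix G a y * (G y)⁻¹) b d) U := by
  simp only [← sum_gInv_gInv_mul]
  exact ContDiffOn.sum fun j _ => ContDiffOn.sum fun k _ =>
    ((hG.contDiffOn_gInv j b).mul (hG.contDiffOn_gInv d k)).mul (hG.contDiffOn_torsion a j k)

theorem contDiffOn_torsionDeriv (hG : IsMetricOn U G) (a m j k : Fin n) :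
    ContDiffOn ℝ ∞ (fun z => torsionDeriv G a m z j k) U := by
  have hT := hG.contDiffOn_torsion a
  have hd : ∀ j k, ContDiffOn ℝ ∞ (fun z => matD (dzbar m) G z j k) U := fun j k =>
    (isFirstOrder_dzbar m).contDiffOn hG.isOpen (hG.smooth j k)
  simp only [torsionDeriv, Matrix.add_apply, Matrix.neg_apply, Matrix.mul_apply, Finset.sum_mul]
  refine (((isFirstOrder_dzbar m).contDiffOn hG.isOpen (hT j k)).neg.add ?_).add ?_
  · exact ContDiffOn.sum fun p _ => ContDiffOn.sum fun q _ =>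
      ((hd _ _).mul (hG.contDiffOn_gInv _ _)).mul (hT _ _)
  · exact ContDiffOn.sum fun p _ => ContDiffOn.sum fun q _ =>
      ((hT _ _).mul (hG.contDiffOn_gInv _ _)).mul (hd _ _)

theorem isL2Adjoint_delStarDelKahler (hG : IsMetricOn U G) :
    IsL2Adjoint U G del (del (kahlerForm G)) (delStarDelKahler G) := by
  refine isL2Adjoint_del_one_one hG (fun i j k => ?_) (fun z i j k => ?_) (fun j k => ?_)
    fun z hz b d => ?_
  · exact (contDiffOn_const.mul (hG.contDiffOn_torsion i j k)).congr
      fun z hz => hG.del_kahlerForm hz i j k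
  · rw [del_one, del_one, neg_sub]
  · exact contDiffOn_const.mul (ContDiffOn.sum fun a _ => ContDiffOn.sum fun m _ =>
      (hG.contDiffOn_gInv a m).mul ((hG.contDiffOn_torsionDeriv a m _ _).sub
        ((hG.contDiffOn_trTorsionBar m).mul (hG.contDiffOn_torsion a _ _))))
  -- Splitting off the weight `g^{a m̄} det g` separates its divergence, which yields the `τ̄ T`
  -- term, from the derivative of the raised torsion, which yields `torsionDeriv`.
  have h : ∀ m, dzbar m (fun y => (∑ i, ∑ j, ∑ k, gInv G y i m * gInv G y j b * gInv G y d k *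
      del (kahlerForm G) y ![i, j] ![k]) * (G y).det) z
      = Complex.I / 2 * ∑ a, (dzbar m (fun y => gInv G y a m * (G y).det) z *
          ((G z)⁻¹ * torsionMatrix G a z * (G z)⁻¹) b d
        - gInv G z a m * (G z).det * ((G z)⁻¹ * torsionDeriv G a m z * (G z)⁻¹) b d) := by
    intro m
    have hd : ∀ a, DifferentiableAt ℝ (fun y => gInv G y a m * (G y).det *
        ((G y)⁻¹ * torsionMatrix G a y * (G y)⁻¹) b d) z := fun a =>
      hG.differentiableAt hz ((hG.contDiffOn_gInv_mul_det a m).mul (hG.contDiffOn_sandwich a b d))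
    rw [(isFirstOrder_dzbar m).congr_on hG.isOpen (h := fun y => Complex.I / 2 *
      ∑ a, gInv G y a m * (G y).det * ((G y)⁻¹ * torsionMatrix G a y * (G y)⁻¹) b d) _ hz,
      (isFirstOrder_dzbar m).const_mul _ (DifferentiableAt.fun_sum fun a _ => hd a),
      (isFirstOrder_dzbar m).sum _ fun a _ => hd a]
    · congr 1
      refine Finset.sum_congr rfl fun a _ => ?_
      rw [(isFirstOrder_dzbar m).mul (hG.differentiableAt hz (hG.contDiffOn_gInv_mul_det a m))
        (hG.differentiableAt hz (hG.contDiffOn_sandwich a b d))]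
      have := congrFun₂ (hG.matD_sandwich hz a m) b d
      rw [matD, Matrix.neg_apply] at this
      rw [this]
      ring
    · intro y hy
      simp only [hG.del_kahlerForm hy, Finset.sum_mul, Finset.mul_sum, ← sum_gInv_gInv_mul]
      refine Finset.sum_congr rfl fun i _ => Finset.sum_congr rfl fun j _ =>
        Finset.sum_congr rfl fun k _ => ?_
      simp only [torsionMatrix]
      ring
  have h1 : ∑ m, ∑ a, dzbar m (fun y => gInv G y a m * (G y).det) z *
      ((G z)⁻¹ * torsionMatrix G a z * (G z)⁻¹) b d
      = (G z).det * ∑ a, ∑ m, gInv G z a m * (trTorsionBar G z m *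
        ((G z)⁻¹ * torsionMatrix G a z * (G z)⁻¹) b d) := by
    rw [Finset.sum_comm, Finset.mul_sum]
    refine Finset.sum_congr rfl fun a _ => ?_
    rw [← Finset.sum_mul, hG.sum_dzbar_gInv_mul_det hz, mul_assoc, Finset.sum_mul]
    simp only [mul_assoc]
  have h2 : ∑ j, ∑ k, gInv G z j b * gInv G z d k * delStarDelKahler G z ![j] ![k]
      = Complex.I / 2 * ∑ a, ∑ m, gInv G z a m *
        (((G z)⁻¹ * torsionDeriv G a m z * (G z)⁻¹) b d -
          trTorsionBar G z m * ((G z)⁻¹ * torsionMatrix G a z * (G z)⁻¹) b d) := by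
    have := sum_gInv_gInv_mul G z (fun j k => delStarDelKahler G z ![j] ![k]) b d
    rw [this]
    have e : (fun j k => delStarDelKahler G z ![j] ![k] : Matrix (Fin n) (Fin n) ℂ)
        = (Complex.I / 2) • ∑ a, ∑ m, gInv G z a m •
          (torsionDeriv G a m z - trTorsionBar G z m • torsionMatrix G a z) := by
      ext j k
      simp [delStarDelKahler, Matrix.sum_apply, torsionMatrix]
    rw [e]
    simp only [Matrix.mul_smul, Matrix.smul_mul, Matrix.mul_sum, Matrix.sum_mul, Matrix.mul_sub,
      Matrix.sub_mul, Matrix.smul_apply, Matrix.sum_apply, Matrix.sub_apply, smul_eq_mul]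
  have h3 : ∑ m, ∑ a, gInv G z a m * (G z).det *
      ((G z)⁻¹ * torsionDeriv G a m z * (G z)⁻¹) b d
      = (G z).det * ∑ a, ∑ m, gInv G z a m * ((G z)⁻¹ * torsionDeriv G a m z * (G z)⁻¹) b d := by
    rw [Finset.sum_comm, Finset.mul_sum]
    refine Finset.sum_congr rfl fun a _ => ?_
    rw [Finset.mul_sum]
    exact Finset.sum_congr rfl fun m _ => by ring
  simp only [h, h2, ← Finset.mul_sum, Finset.sum_sub_distrib, h1, h3, mul_sub]
  ring

end IsMetricOn

/-! ### The curvature identity -/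

namespace IsMetricOn

variable {U : Set (CSpace n)} {G : CSpace n → Matrix (Fin n) (Fin n) ℂ} {z : CSpace n}

/-- In matrix form `Γ_l = ∂_l G * G⁻¹`; differentiating and multiplying by `G` on the right clears
the outer inverse. -/
theorem chernCurvature_eq (hG : IsMetricOn U G) (hz : z ∈ U) (l m j k : Fin n) :
    chernCurvature G z l m j k = -dzbar m (dz l fun y => G y j k) z
      + (matD (dz l) G z * (G z)⁻¹ * matD (dzbar m) G z) j k := by
  have hd : ∀ j k, DifferentiableAt ℝ (fun y => matD (dz l) G y j k) z := fun j k =>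
    hG.differentiableAt hz ((isFirstOrder_dz l).contDiffOn hG.isOpen (hG.smooth j k))
  have hP : ∀ j k, DifferentiableAt ℝ (fun y => (G y)⁻¹ j k) z := fun j k =>
    hG.differentiableAt hz (hG.contDiffOn_gInv k j)
  have hΓ : ∀ p, dzbar m (chernGamma G l j p) z
      = matD (dzbar m) (fun y => matD (dz l) G y * (G y)⁻¹) z j p := by
    intro p
    rw [matD]
    congr 1
    ext y
    rw [Matrix.mul_apply]
    exact Finset.sum_congr rfl fun q _ => mul_comm _ _
  have h1 : chernCurvature G z l m j k
      = (-(matD (dzbar m) (fun y => matD (dz l) G y * (G y)⁻¹) z * G z)) j k := by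
    rw [chernCurvature, Matrix.neg_apply, Matrix.mul_apply]
    simp only [hΓ, mul_comm (G z _ _)]
  rw [h1, matD_mul (H := fun y => (G y)⁻¹) (isFirstOrder_dzbar m) hd hP,
    hG.matD_inv (isFirstOrder_dzbar m) hz]
  have h2 : -((matD (dzbar m) (matD (dz l) G) z * (G z)⁻¹ +
      matD (dz l) G z * -((G z)⁻¹ * matD (dzbar m) G z * (G z)⁻¹)) * G z)
      = -matD (dzbar m) (matD (dz l) G) z + matD (dz l) G z * (G z)⁻¹ * matD (dzbar m) G z := by
    simp only [add_mul, mul_neg, neg_mul, mul_assoc, Matrix.nonsing_inv_mul _ (hG.isUnit_det hz),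
      mul_one, neg_add, neg_neg]
  rw [h2]
  rfl

theorem chernS_eq (hG : IsMetricOn U G) (hz : z ∈ U) (j k : Fin n) :
    chernS G z j k = ∑ a, ∑ m, gInv G z a m * (-dzbar m (dz a fun y => G y j k) z
      + (matD (dz a) G z * (G z)⁻¹ * matD (dzbar m) G z) j k) := by
  simp only [chernS, hG.chernCurvature_eq hz]

theorem torsion_antisymm (G : CSpace n → Matrix (Fin n) (Fin n) ℂ) (z : CSpace n) (i j k : Fin n) :
    torsion G z j i k = -torsion G z i j k := by
  simp only [torsion, torsionUp, ← Finset.sum_neg_distrib]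
  exact Finset.sum_congr rfl fun l _ => by ring

/-- Each of the two terms of the barred torsion contributes the same amount, since exchanging the
contracted pairs flips the sign of the other torsion factor. Hence the factor 2. -/
theorem Q2_eq (hG : IsMetricOn U G) (hz : z ∈ U) (j k : Fin n) :
    Q2 G z j k = 2 * ∑ a, ∑ m, gInv G z a m *
      (matD (dzbar m) G z * (G z)⁻¹ * torsionMatrix G a z) j k := by
  have h1 : ∀ a m, gInv G z a m * (matD (dzbar m) G z * (G z)⁻¹ * torsionMatrix G a z) j k
      = ∑ b, ∑ q, gInv G z a m * gInv G z b q *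
        (dzbar m (fun y => G y j q) z * torsion G z a b k) := by
    intro a m
    simp only [Matrix.mul_apply, Finset.sum_mul, Finset.mul_sum]
    refine Finset.sum_congr rfl fun b _ => Finset.sum_congr rfl fun q _ => ?_
    simp only [gInv, matD, torsionMatrix]
    ring
  have h2 : ∑ a, ∑ m, ∑ b, ∑ q, gInv G z a m * gInv G z b q *
        (dzbar q (fun y => G y j m) z * torsion G z a b k)
      = -∑ a, ∑ m, ∑ b, ∑ q, gInv G z a m * gInv G z b q *
        (dzbar m (fun y => G y j q) z * torsion G z a b k) := by
    rw [Finset.sum_congr rfl fun a _ => Finset.sum_comm, Finset.sum_comm]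
    simp only [← Finset.sum_neg_distrib]
    refine Finset.sum_congr rfl fun b _ => ?_
    rw [Finset.sum_congr rfl fun a _ => Finset.sum_comm, Finset.sum_comm]
    refine Finset.sum_congr rfl fun q _ => Finset.sum_congr rfl fun a _ =>
      Finset.sum_congr rfl fun m _ => ?_
    rw [torsion_antisymm G z b a k]
    ring
  simp only [Q2, hG.torsionBar_eq hz, sub_mul, mul_sub, Finset.sum_sub_distrib, h1, h2]
  ring

/-- Only the contractions are regrouped, to exhibit the torsion traces that the adjoints of `ω`
produce. -/
theorem Q4_eq (j k : Fin n) :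
    Q4 G z j k = (1 / 2 : ℂ) * ((∑ p, ∑ q, gInv G z p q * trTorsion G z p * torsionBar G z q k j)
      + ∑ a, ∑ m, gInv G z a m * (trTorsionBar G z m * torsion G z a j k)) := by
  simp only [Q4, mul_add, Finset.sum_add_distrib]
  congr 2
  · rw [Finset.sum_congr rfl fun a _ => Finset.sum_comm, Finset.sum_comm]
    refine Finset.sum_congr rfl fun p _ => ?_
    rw [Finset.sum_congr rfl fun a _ => Finset.sum_comm, Finset.sum_comm]
    refine Finset.sum_congr rfl fun q _ => ?_
    rw [trTorsion, Finset.mul_sum, Finset.sum_mul]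
    refine Finset.sum_congr rfl fun a _ => ?_
    rw [Finset.mul_sum, Finset.sum_mul]
    exact Finset.sum_congr rfl fun b _ => by ring
  · rw [Finset.sum_congr rfl fun a _ => Finset.sum_comm, Finset.sum_comm]
    refine Finset.sum_congr rfl fun p _ => ?_
    rw [Finset.sum_congr rfl fun a _ => Finset.sum_comm, Finset.sum_comm]
    refine Finset.sum_congr rfl fun q _ => ?_
    rw [trTorsionBar, Finset.sum_mul, Finset.mul_sum]
    refine Finset.sum_congr rfl fun a _ => ?_
    rw [Finset.sum_mul, Finset.mul_sum]
    exact Finset.sum_congr rfl fun b _ => by ring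

open scoped ComplexOrder in
theorem ofReal_det_re (hG : IsMetricOn U G) (hz : z ∈ U) :
    0 < (G z).det.re ∧ (((G z).det.re : ℝ) : ℂ) = (G z).det := by
  have h := Complex.pos_iff.1 (hG.posDef z hz).det_pos
  exact ⟨h.1, Complex.ext rfl h.2⟩

theorem contDiffOn_logDet (hG : IsMetricOn U G) (I J : Fin 0 → Fin n) :
    ContDiffOn ℝ ∞ (fun z => logDet G z I J) U := by
  have h : ContDiffOn ℝ ∞ (fun z => Real.log (G z).det.re) U :=
    (Complex.reCLM.contDiff.comp_contDiffOn hG.contDiffOn_det).log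
      fun z hz => (hG.ofReal_det_re hz).1.ne'
  exact Complex.ofRealCLM.contDiff.comp_contDiffOn h

theorem deriv_logDet (hG : IsMetricOn U G) (hz : z ∈ U) {D : (CSpace n → ℂ) → CSpace n → ℂ}
    (hD : IsFirstOrder D) (I J : Fin 0 → Fin n) :
    D (fun y => logDet G y I J) z = ∑ p, ∑ q, gInv G z p q * D (fun y => G y p q) z := by
  -- Differentiating `det g = exp (log det g)` and cancelling `det g` reduces the claim to Jacobi's
  -- formula.
  have hexp : Set.EqOn (fun y => (G y).det) (fun y => Complex.exp (logDet G y I J)) U := by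
    intro y hy
    simp only [logDet]
    rw [← Complex.ofReal_exp, Real.exp_log (hG.ofReal_det_re hy).1, (hG.ofReal_det_re hy).2]
  have hL := hG.differentiableAt hz (hG.contDiffOn_logDet I J)
  have h1 := hG.deriv_det hD hz
  rw [hD.congr_on hG.isOpen hexp hz] at h1
  have h2 : D (fun y => Complex.exp (logDet G y I J)) z
      = (G z).det * D (fun y => logDet G y I J) z := by
    obtain ⟨a, b, v, w, H⟩ := hD
    rw [H, H, hL.hasFDerivAt.cexp.fderiv, show (G z).det = _ from hexp hz]
    simp only [smul_apply, smul_eq_mul]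
    ring
  exact mul_left_cancel₀ (hG.det_ne_zero hz) (h2.symm.trans h1)

theorem trTorsionBar_eq (hG : IsMetricOn U G) (hz : z ∈ U) (k : Fin n) :
    trTorsionBar G z k = dzbar k (fun y => logDet G y ![] ![]) z
      - ∑ p, ∑ q, gInv G z p q * dzbar q (fun y => G y p k) z := by
  simp only [hG.deriv_logDet hz (isFirstOrder_dzbar k), trTorsionBar, hG.torsionBar_eq hz, mul_sub,
    Finset.sum_sub_distrib]

/-- This displays the three pieces that cancel in `Ψ`: the Hessian of `log det g`, a quadratic term
from the derivative of the inverse metric, and second derivatives with `∂_j` and `∂_{q̄}` commuted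
to match those of `torsionDeriv_apply`. -/
theorem dz_trTorsionBar (hG : IsMetricOn U G) (hz : z ∈ U) (j k : Fin n) :
    dz j (fun y => trTorsionBar G y k) z
      = dz j (fun y => dzbar k (fun x => logDet G x ![] ![]) y) z
        + ∑ p, ∑ q, ((∑ m, ∑ r, gInv G z p r * gInv G z m q * dz j (fun y => G y m r) z) *
            dzbar q (fun y => G y p k) z
          - gInv G z p q * dzbar q (dz j fun y => G y p k) z) := by
  have hb : ∀ q p, ContDiffOn ℝ ∞ (dzbar q fun y => G y p k) U := fun q p =>
    (isFirstOrder_dzbar q).contDiffOn hG.isOpen (hG.smooth p k)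
  have hs : ∀ p q, DifferentiableAt ℝ (fun y => gInv G y p q * dzbar q (fun x => G x p k) y) z :=
    fun p q => hG.differentiableAt hz ((hG.contDiffOn_gInv p q).mul (hb q p))
  have hl : ContDiffOn ℝ ∞ (dzbar k fun y => logDet G y ![] ![]) U :=
    (isFirstOrder_dzbar k).contDiffOn hG.isOpen (hG.contDiffOn_logDet _ _)
  rw [(isFirstOrder_dz j).congr_on hG.isOpen (fun y hy => hG.trTorsionBar_eq hy k) hz,
    (isFirstOrder_dz j).sub (hG.differentiableAt hz hl)
      (DifferentiableAt.fun_sum fun p _ => DifferentiableAt.fun_sum fun q _ => hs p q),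
    (isFirstOrder_dz j).sum _ (fun p _ => DifferentiableAt.fun_sum fun q _ => hs p q),
    sub_eq_add_neg, ← Finset.sum_neg_distrib]
  refine congrArg₂ _ rfl (Finset.sum_congr rfl fun p _ => ?_)
  rw [(isFirstOrder_dz j).sum _ (fun q _ => hs p q), ← Finset.sum_neg_distrib]
  refine Finset.sum_congr rfl fun q _ => ?_
  rw [(isFirstOrder_dz j).mul (hG.differentiableAt hz (hG.contDiffOn_gInv p q))
      (hG.differentiableAt hz (hb q p)), hG.deriv_gInv (isFirstOrder_dz j) hz,
    (isFirstOrder_dz j).comm (isFirstOrder_dzbar q) hG.isOpen (hG.smooth p k) hz]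
  ring

/-- Split `T_{a j r̄} = ∂_a g_{j r̄} - ∂_j g_{a r̄}`: the first part is the quadratic term of `S`,
the second cancels the quadratic term of `dz_trTorsionBar`. -/
theorem sum_torsionMatrix_mul (hG : IsMetricOn U G) (hz : z ∈ U) (j k : Fin n) :
    ∑ a, ∑ m, gInv G z a m * (torsionMatrix G a z * (G z)⁻¹ * matD (dzbar m) G z) j k
      = ∑ a, ∑ m, gInv G z a m * (matD (dz a) G z * (G z)⁻¹ * matD (dzbar m) G z) j k
        - ∑ p, ∑ q, (∑ m, ∑ r, gInv G z p r * gInv G z m q * dz j (fun y => G y m r) z) *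
            dzbar q (fun y => G y p k) z := by
  have h : ∀ a m, gInv G z a m * (torsionMatrix G a z * (G z)⁻¹ * matD (dzbar m) G z) j k
      = gInv G z a m * (matD (dz a) G z * (G z)⁻¹ * matD (dzbar m) G z) j k
        - ∑ p, ∑ r, gInv G z p r * gInv G z a m * dz j (fun y => G y a r) z *
            dzbar m (fun y => G y p k) z := by
    intro a m
    simp only [Matrix.mul_apply, Finset.sum_mul, Finset.mul_sum, ← Finset.sum_sub_distrib]
    refine Finset.sum_congr rfl fun p _ => Finset.sum_congr rfl fun r _ => ?_
    simp only [torsionMatrix, matD, gInv, hG.torsion_eq hz]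
    ring
  simp only [h, Finset.sum_sub_distrib, Finset.sum_mul]
  exact congrArg₂ _ rfl ((Finset.sum_congr rfl fun a _ => Finset.sum_comm).trans
    (Finset.sum_comm.trans (Finset.sum_congr rfl fun p _ => Finset.sum_comm)))

theorem torsionDeriv_apply (hG : IsMetricOn U G) (hz : z ∈ U) (a m j k : Fin n) :
    torsionDeriv G a m z j k = -dzbar m (dz a fun y => G y j k) z
      + dzbar m (dz j fun y => G y a k) z
      + (matD (dzbar m) G z * (G z)⁻¹ * torsionMatrix G a z) j k
      + (torsionMatrix G a z * (G z)⁻¹ * matD (dzbar m) G z) j k := by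
  have hb : ∀ a j, DifferentiableAt ℝ (dz a fun y => G y j k) z := fun a j =>
    hG.differentiableAt hz ((isFirstOrder_dz a).contDiffOn hG.isOpen (hG.smooth j k))
  have : matD (dzbar m) (torsionMatrix G a) z j k
      = dzbar m (dz a fun y => G y j k) z - dzbar m (dz j fun y => G y a k) z := by
    rw [← (isFirstOrder_dzbar m).sub (hb a j) (hb j a)]
    exact (isFirstOrder_dzbar m).congr_on hG.isOpen (fun y hy => hG.torsion_eq hy a j k) hz
  rw [torsionDeriv, Matrix.add_apply, Matrix.add_apply, Matrix.neg_apply, this]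
  ring

theorem Psi_apply (hG : IsMetricOn U G) (hz : z ∈ U) (j k : Fin n) :
    Psi U G z ![j] ![k] = Complex.I / 2 *
      ((∑ a, ∑ m, gInv G z a m *
          (torsionDeriv G a m z j k - trTorsionBar G z m * torsion G z a j k))
        + dz j (fun y => trTorsionBar G y k) z
        - dz j (fun y => dzbar k (fun x => logDet G x ![] ![]) y) z
        - ∑ p, ∑ q, gInv G z p q * trTorsion G z p * torsionBar G z q k j) := by
  have e1 : delStar U G (del (kahlerForm G)) z ![j] ![k] = delStarDelKahler G z ![j] ![k] := by
    rw [delStar, eqOn_l2Adjoint hG le_rfl le_rfl hG.isL2Adjoint_delStarDelKahler hz]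
  -- The adjoint is differentiated here, so its explicit form is needed on all of `U`, not only at
  -- `z`.
  have e2 : del (delStar U G (kahlerForm G)) z ![j] ![k]
      = -(Complex.I / 2) * dz j (fun y => trTorsionBar G y k) z := by
    rw [del_zero, ← (isFirstOrder_dz j).const_mul _
      (hG.differentiableAt hz (hG.contDiffOn_trTorsionBar k))]
    refine (isFirstOrder_dz j).congr_on hG.isOpen (fun y hy => ?_) hz
    rw [delStar, eqOn_l2Adjoint hG zero_le_one le_rfl hG.isL2Adjoint_delStarKahler hy]
    rfl
  have e3 : del (delbar (logDet G)) z ![j] ![k]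
      = dz j (fun y => dzbar k (fun x => logDet G x ![] ![]) y) z := by
    rw [del_zero]
    simp only [delbar_zero, pow_zero, one_mul]
  have e4 : hook G (delbarStar U G (kahlerForm G)) (delbar (kahlerForm G)) z ![j] ![k]
      = 1 / 4 * ∑ p, ∑ q, gInv G z p q * trTorsion G z p * torsionBar G z q k j := by
    rw [hook, Finset.mul_sum]
    refine Finset.sum_congr rfl fun p _ => ?_
    rw [Finset.mul_sum]
    refine Finset.sum_congr rfl fun q _ => ?_
    rw [Matrix.cons_val_zero, hG.delbar_kahlerForm hz, delbarStar,
      eqOn_l2Adjoint hG le_rfl zero_le_one hG.isL2Adjoint_delbarStarKahler hz, delbarStarKahler,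
      Matrix.cons_val_zero]
    linear_combination (-(1 / 4) * gInv G z p q * trTorsion G z p * torsionBar G z q k j) *
      Complex.I_sq
  simp only [Psi, Pi.sub_apply, Pi.smul_apply, smul_eq_mul]
  rw [e1, e2, e3, e4, delStarDelKahler, Matrix.cons_val_zero, Matrix.cons_val_zero]
  ring

theorem Psi_eq (hG : IsMetricOn U G) (hz : z ∈ U) (I J : Fin 1 → Fin n) :
    Psi U G z I J = Complex.I / 2 * (chernS G z (I 0) (J 0) + 1 / 2 * Q2 G z (I 0) (J 0)
      - 2 * Q4 G z (I 0) (J 0)) := by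
  rw [eq_vec_one I, eq_vec_one J, hG.Psi_apply hz]
  simp only [Matrix.cons_val_zero]
  generalize I 0 = j
  generalize J 0 = k
  congr 1
  rw [hG.Q2_eq hz, Q4_eq, hG.chernS_eq hz, hG.dz_trTorsionBar hz]
  have h := hG.sum_torsionMatrix_mul hz j k
  simp only [hG.torsionDeriv_apply hz, mul_add, mul_sub, Finset.sum_add_distrib,
    Finset.sum_sub_distrib, mul_neg, Finset.sum_neg_distrib] at h ⊢
  rw [h]
  ring

end IsMetricOn

/-! ### Components of Hermitian metrics in charts -/

/-- A bilinear form that is invariant under `J` is determined by its complex components. -/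
theorem eq_realTensor {B : CSpace n → CSpace n → ℝ}
    (add_left : ∀ u u' v, B (u + u') v = B u v + B u' v)
    (smul_left : ∀ (c : ℝ) u v, B ((c : ℂ) • u) v = c * B u v)
    (symm : ∀ u v, B u v = B v u)
    (J_invariant : ∀ u v, B (Complex.I • u) (Complex.I • v) = B u v) (u v : CSpace n) :
    B u v = realTensor (fun j k => (B (Pi.single j 1) (Pi.single k 1) : ℂ)
      + Complex.I * (B (Pi.single j 1) (Pi.single k Complex.I) : ℂ)) u v := by
  have add_right : ∀ u v v', B u (v + v') = B u v + B u v' := fun u v v' => by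
    rw [symm, add_left, symm v, symm v']
  have smul_right : ∀ (c : ℝ) u v, B u ((c : ℂ) • v) = c * B u v := fun c u v => by
    rw [symm, smul_left, symm v]
  have zero_left : ∀ v, B 0 v = 0 := fun v => by
    have := smul_left 0 0 v
    simpa using this
  have sum_left : ∀ (s : Finset (Fin n)) (F : Fin n → CSpace n) v,
      B (∑ j ∈ s, F j) v = ∑ j ∈ s, B (F j) v := fun s F v =>
    map_sum (AddMonoidHom.mk' (fun x => B x v) fun x y => add_left x y v) F s
  have sum_right : ∀ (s : Finset (Fin n)) (F : Fin n → CSpace n) u,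
      B u (∑ j ∈ s, F j) = ∑ j ∈ s, B u (F j) := fun s F u =>
    map_sum (AddMonoidHom.mk' (fun x => B u x) fun x y => add_right u x y) F s
  have single : ∀ (j : Fin n) (c : ℂ), (Pi.single j c : CSpace n)
      = ((c.re : ℝ) : ℂ) • Pi.single j 1 + ((c.im : ℝ) : ℂ) • Pi.single j Complex.I := by
    intro j c
    rw [← Pi.single_smul', ← Pi.single_smul', ← Pi.single_add, smul_eq_mul, smul_eq_mul, mul_one,
      Complex.re_add_im]
  have I_single : ∀ j : Fin n, (Pi.single j Complex.I : CSpace n)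
      = Complex.I • Pi.single j 1 := fun j => by
    rw [← Pi.single_smul', smul_eq_mul, mul_one]
  -- Invariance under `J` with `J² = -1` makes `J` skew, so values on `J e_j` reduce to the two real
  -- numbers in each component.
  have hJ : ∀ u v, B (Complex.I • u) v = -B u (Complex.I • v) := fun u v => by
    have h : Complex.I • Complex.I • u = ((-1 : ℝ) : ℂ) • u := by
      rw [smul_smul, Complex.I_mul_I]; simp
    rw [← J_invariant, h, smul_left]
    ring
  have hB : B u v = ∑ j, ∑ k, B (Pi.single j (u j)) (Pi.single k (v k)) := by
    conv_lhs => rw [← Finset.univ_sum_single u, ← Finset.univ_sum_single v]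
    simp only [sum_left, sum_right]
  simp only [hB, realTensor, Complex.re_sum]
  refine Finset.sum_congr rfl fun j _ => Finset.sum_congr rfl fun k _ => ?_
  rw [single j (u j), single k (v k)]
  simp only [add_left, add_right, smul_left, smul_right]
  rw [I_single j, I_single k, J_invariant, hJ]
  simp
  ring

open scoped ComplexOrder in
theorem posDef_of_invariant {B : CSpace n → CSpace n → ℝ}
    (add_left : ∀ u u' v, B (u + u') v = B u v + B u' v)
    (smul_left : ∀ (c : ℝ) u v, B ((c : ℂ) • u) v = c * B u v)
    (symm : ∀ u v, B u v = B v u) (pos : ∀ u, u ≠ 0 → 0 < B u u)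
    (J_invariant : ∀ u v, B (Complex.I • u) (Complex.I • v) = B u v) :
    Matrix.PosDef (fun j k => (B (Pi.single j 1) (Pi.single k 1) : ℂ)
      + Complex.I * (B (Pi.single j 1) (Pi.single k Complex.I) : ℂ) :
        Matrix (Fin n) (Fin n) ℂ) := by
  have hherm : Matrix.IsHermitian (fun j k => (B (Pi.single j 1) (Pi.single k 1) : ℂ)
      + Complex.I * (B (Pi.single j 1) (Pi.single k Complex.I) : ℂ) :
        Matrix (Fin n) (Fin n) ℂ) := by
    refine Matrix.IsHermitian.ext fun j k => ?_
    have h : B (Pi.single k 1) (Pi.single j Complex.I)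
        = -B (Pi.single j 1) (Pi.single k Complex.I) := by
      have I_single : ∀ j : Fin n, (Pi.single j Complex.I : CSpace n)
          = Complex.I • Pi.single j 1 := fun j => by
        rw [← Pi.single_smul', smul_eq_mul, mul_one]
      have h1 : Complex.I • Complex.I • (Pi.single j 1 : CSpace n)
          = ((-1 : ℝ) : ℂ) • Pi.single j 1 := by
        rw [smul_smul, Complex.I_mul_I]; simp
      rw [I_single, I_single, symm, ← J_invariant, h1, smul_left]
      ring
    simp only [star_add, star_mul', Complex.star_def, Complex.conj_ofReal, Complex.conj_I]
    rw [h, symm]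
    push_cast
    ring
  refine Matrix.PosDef.of_dotProduct_mulVec_pos hherm fun x hx => ?_
  refine Complex.pos_iff.2 ⟨?_, ?_⟩
  · have h := pos (star x) (star_ne_zero.2 hx)
    rw [eq_realTensor add_left smul_left symm J_invariant] at h
    unfold realTensor at h
    refine h.trans_eq (congrArg Complex.re ?_)
    simp only [dotProduct, Matrix.mulVec, Finset.mul_sum]
    refine Finset.sum_congr rfl fun j _ => Finset.sum_congr rfl fun k _ => ?_
    simp only [Pi.star_apply, Complex.star_def, Complex.conj_conj]
    ring
  · exact (hherm.im_star_dotProduct_mulVec_self x).symm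

/-- The differential of an inverse chart is complex linear and injective, so pulling back preserves
bilinearity, `J`-invariance and positivity. -/
theorem HermitianMetric.isMetricOn_comp {M : Type*} [TopologicalSpace M]
    [ChartedSpace (CSpace n) M] [IsManifold 𝓘(ℂ, CSpace n) ω M] (g : HermitianMetric n M)
    {φ : OpenPartialHomeomorph M (CSpace n)}
    (hφ : φ ∈ IsManifold.maximalAtlas 𝓘(ℂ, CSpace n) ω M) :
    IsMetricOn φ.target (g.comp φ) where
  isOpen := φ.open_target
  smooth j k := (Complex.ofRealCLM.contDiff.comp_contDiffOn (g.smooth φ hφ _ _)).add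
    (contDiffOn_const.mul (Complex.ofRealCLM.contDiff.comp_contDiffOn (g.smooth φ hφ _ _)))
  posDef z hz := by
    have hmd : φ.MDifferentiable 𝓘(ℂ, CSpace n) 𝓘(ℂ, CSpace n) :=
      ⟨(contMDiffOn_of_mem_maximalAtlas hφ).mdifferentiableOn (by simp),
        (contMDiffOn_symm_of_mem_maximalAtlas hφ).mdifferentiableOn (by simp)⟩
    have hinj : Function.Injective (chartVec φ z) := hmd.symm.mfderiv_injective hz
    have hadd : ∀ u v, chartVec φ z (u + v) = chartVec φ z u + chartVec φ z v := fun u v =>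
      map_add (mfderiv 𝓘(ℂ, CSpace n) 𝓘(ℂ, CSpace n) φ.symm z) u v
    have hsmul : ∀ (c : ℂ) u, chartVec φ z (c • u) = c • chartVec φ z u := fun c u =>
      map_smul (mfderiv 𝓘(ℂ, CSpace n) 𝓘(ℂ, CSpace n) φ.symm z) c u
    refine posDef_of_invariant
      (B := fun u v => g.val (φ.symm z) (chartVec φ z u) (chartVec φ z v)) ?_ ?_ ?_ ?_ ?_
    · intro u u' v
      rw [hadd, g.add_left]
    · intro c u v
      rw [hsmul, g.smul_left]
    · intro u v
      rw [g.symm]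
    · intro u hu
      refine g.pos _ _ fun h => hu (hinj ?_)
      rw [h]
      exact (map_zero (mfderiv 𝓘(ℂ, CSpace n) 𝓘(ℂ, CSpace n) φ.symm z)).symm
    · intro u v
      rw [hsmul, hsmul, g.J_invariant]

end HermitianFlow

end

/-! ### The identity for `Ξ` and the equivalence of the two flow equations -/

theorem mainTheorem8 {n : ℕ} {M : Type*} [TopologicalSpace M]
    [ChartedSpace (HermitianFlow.CSpace n) M]
    [IsManifold 𝓘(ℂ, HermitianFlow.CSpace n) ω M] :
    (∀ g : HermitianFlow.HermitianMetric n M,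
      ∀ φ ∈ IsManifold.maximalAtlas 𝓘(ℂ, HermitianFlow.CSpace n) ω M,
        HermitianFlow.HasUniqueL2Adjoint φ.target (g.comp φ) HermitianFlow.del
          (HermitianFlow.kahlerForm (g.comp φ)) ∧
        HermitianFlow.HasUniqueL2Adjoint φ.target (g.comp φ) HermitianFlow.delbar
          (HermitianFlow.kahlerForm (g.comp φ)) ∧
        HermitianFlow.HasUniqueL2Adjoint φ.target (g.comp φ) HermitianFlow.del
          (HermitianFlow.del (HermitianFlow.kahlerForm (g.comp φ))) ∧
        Set.EqOn (HermitianFlow.Xi (g.comp φ))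
          (HermitianFlow.Psi φ.target (g.comp φ)
            - HermitianFlow.halfIForm (fun z =>
                (1 / 2 : ℂ) • HermitianFlow.Q2 (g.comp φ) z
                  - (2 : ℂ) • HermitianFlow.Q4 (g.comp φ) z))
          φ.target) ∧
    (∀ (D : Set ℝ) (g : ℝ → HermitianFlow.HermitianMetric n M),
      HermitianFlow.IsHCF D g ↔
        ∀ t ∈ D, ∀ φ ∈ IsManifold.maximalAtlas 𝓘(ℂ, HermitianFlow.CSpace n) ω M,
          ∀ z ∈ φ.target, ∀ (I J : Fin 1 → Fin n),
            HasDerivWithinAt (fun s => HermitianFlow.kahlerForm ((g s).comp φ) z I J)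
              ((-HermitianFlow.Psi φ.target ((g t).comp φ)
                + HermitianFlow.halfIForm (fun y =>
                    (1 / 2 : ℂ) • HermitianFlow.Q1 ((g t).comp φ) y
                      + (1 / 4 : ℂ) • HermitianFlow.Q2 ((g t).comp φ) y
                      - (1 / 2 : ℂ) • HermitianFlow.Q3 ((g t).comp φ) y
                      - HermitianFlow.Q4 ((g t).comp φ) y)) z I J) D t) := by
  refine ⟨fun g φ hφ => ?_, fun D g => ?_⟩
  · have hG := g.isMetricOn_comp hφ
    refine ⟨HermitianFlow.hasUniqueL2Adjoint hG zero_le_one le_rfl hG.isL2Adjoint_delStarKahler,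
      HermitianFlow.hasUniqueL2Adjoint hG le_rfl zero_le_one hG.isL2Adjoint_delbarStarKahler,
      HermitianFlow.hasUniqueL2Adjoint hG le_rfl le_rfl hG.isL2Adjoint_delStarDelKahler,
      fun z hz => ?_⟩
    ext I J
    simp only [HermitianFlow.Xi, HermitianFlow.assocForm_apply, Pi.sub_apply, hG.Psi_eq hz,
      HermitianFlow.halfIForm, Matrix.sub_apply, Matrix.smul_apply, smul_eq_mul]
    ring
  · have hI : Complex.I / 2 ≠ 0 := by simp
    -- Substituting `Psi_eq`, the coefficients of `Q²` and `Q⁴` become `-½ + ¼ = -¼` and `2 - 1 =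
    -- 1`, those of `Q`.
    have key : ∀ t, ∀ φ ∈ IsManifold.maximalAtlas 𝓘(ℂ, HermitianFlow.CSpace n) ω M,
        ∀ z ∈ φ.target, ∀ I J : Fin 1 → Fin n,
        (-HermitianFlow.Psi φ.target ((g t).comp φ) + HermitianFlow.halfIForm (fun y =>
          (1 / 2 : ℂ) • HermitianFlow.Q1 ((g t).comp φ) y
            + (1 / 4 : ℂ) • HermitianFlow.Q2 ((g t).comp φ) y
            - (1 / 2 : ℂ) • HermitianFlow.Q3 ((g t).comp φ) y
            - HermitianFlow.Q4 ((g t).comp φ) y)) z I J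
          = Complex.I / 2 * (-HermitianFlow.chernS ((g t).comp φ) z (I 0) (J 0)
            + HermitianFlow.Qtot ((g t).comp φ) z (I 0) (J 0)) := by
      intro t φ hφ z hz I J
      simp only [Pi.add_apply, Pi.neg_apply, ((g t).isMetricOn_comp hφ).Psi_eq hz,
        HermitianFlow.halfIForm, HermitianFlow.Qtot, Matrix.add_apply, Matrix.sub_apply,
        Matrix.smul_apply, smul_eq_mul]
      ring
    constructor
    · intro h t ht φ hφ z hz I J
      rw [key t φ hφ z hz]
      simp only [HermitianFlow.kahlerForm_apply]
      exact (h t ht φ hφ z hz (I 0) (J 0)).const_mul _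
    · intro h t ht φ hφ z hz j k
      have := h t ht φ hφ z hz ![j] ![k]
      rw [key t φ hφ z hz] at this
      simp only [HermitianFlow.kahlerForm_apply, Matrix.cons_val_zero] at this
      simpa only [← mul_assoc, inv_mul_cancel₀ hI, one_mul] using this.const_mul (Complex.I / 2)⁻¹
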